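/- Let $k,r\ge 0$ and let $G=\mathbb C^k\times G_1\times\cdots\times G_r$, where each $G_i$ is a connected, simply-connected simple complex Lie group with Lie algebra $\mathfrak g_i$ and (complex) Cartan–Killing form $B_i$. A Hermitian metric $g$ on a complex manifold with complex structure $J$ is called BTP (Bismut torsion parallel) if the torsion of its Bismut connection is parallel with respect to that connection; here the Bismut connection is the unique linear connection $\nabla^b$ with $\nabla^b g=0$, $\nabla^b J=0$ whose torsion $T^b$ is totally skew-symmetric, i.e. $(X,Y,Z)\mapsto g(T^b(X,Y),Z)$ is a $3$-form. (1) Every left-invariant BTP Hermitian metric $g$ on $G$ is a product $g=g_0\oplus g_1\oplus\cdots\oplus g_r$ of left-invariant Hermitian metrics $g_0$ on $\mathbb C^k$ and $g_i$ on $G_i$ ($1\le i\le r$), and $g_0$ is Kähler and flat. (2) On each simple factor any two such metrics differ by a constant multiple of a $B$-isometry: if $g,h$ are left-invariant Hermitian metrics on $G_i$ which are both factors of left-invariant BTP Hermitian metrics on $G$ as in (1), or which are both themselves BTP on $G_i$, then there are a constant $c>0$ and a complex linear isomorphism $f:\mathfrak g_i\to\mathfrak g_i$ with $B_i(f(X),f(Y))=B_i(X,Y)$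 such that $$h(X,Y)=c\,g(f(X),Y)\qquad\text{for all }X,Y\in\mathfrak g_i .$$ -/

import Mathlib

open scoped Manifold ContDiff

namespace LieBTP

noncomputable section

/-! ### The real manifold underlying a complex manifold -/

section ComplexManifold

variable (E : Type*) [NormedAddCommGroup E] [NormedSpace ℂ E]

/-- The model of the real manifold underlying a complex manifold modelled on `E`. -/
abbrev realModel : ModelWithCorners ℝ E E := 𝓘(ℝ, E)

variable (M : Type*) [TopologicalSpace M] [ChartedSpace E M]

/-- A complex manifold is, with the same charts, a real manifold. -/
instance isManifold_real [IsManifold 𝓘(ℂ, E) ω M] : IsManifold (realModel E) ω M := by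
  refine isManifold_of_contDiffOn _ _ _ fun e e' he he' => ?_
  have h := (mem_groupoid_of_pregroupoid.1
    (HasGroupoid.compatible (G := contDiffGroupoid ω 𝓘(ℂ, E)) he he')).1
  exact ContDiffOn.restrict_scalars ℝ h

variable {E M}

/-- The complex structure `J` on the real tangent spaces: multiplication by `i` in the chart. -/
def J (x : M) : TangentSpace (realModel E) x →L[ℝ] TangentSpace (realModel E) x :=
  (Complex.I • ContinuousLinearMap.id ℝ E : E →L[ℝ] E)

/-- The identification of the complex tangent space with the real one. -/
def toReal (x : M) (v : TangentSpace 𝓘(ℂ, E) x) : TangentSpace (realModel E) x := v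

variable (E M)

/-- A vector field on the underlying real manifold. -/
abbrev VField : Type _ := (x : M) → TangentSpace (realModel E) x

/-- A field of bilinear forms on the real tangent spaces. -/
abbrev BilinField : Type _ :=
  (x : M) → TangentSpace (realModel E) x →L[ℝ] TangentSpace (realModel E) x →L[ℝ] ℝ

variable [IsManifold 𝓘(ℂ, E) ω M]

/-- A linear connection on the real tangent bundle; `D Y x v` is `(∇_v Y)(x)`. -/
abbrev Connection : Type _ :=
  CovariantDerivative (realModel E) E (fun x : M => TangentSpace (realModel E) x)

variable {E M}

/-- Smooth vector fields (smooth in the real sense). -/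
def IsSmooth (X : VField E M) : Prop :=
  ContMDiff (realModel E) (realModel E).tangent ∞
    (fun x => (⟨x, X x⟩ : TangentBundle (realModel E) M))

/-- `∇ g = 0`. -/
def IsMetric (g : BilinField E M) (D : Connection E M) : Prop :=
  ∀ X Y : VField E M, IsSmooth X → IsSmooth Y → ∀ (x : M) (v : TangentSpace (realModel E) x),
    mvfderiv (realModel E) (fun y => g y (X y) (Y y)) x v
      = g x (D X x v) (Y x) + g x (X x) (D Y x v)

/-- `∇ J = 0`. -/
def IsComplex (D : Connection E M) : Prop :=
  ∀ Y : VField E M, IsSmooth Y → ∀ (x : M) (v : TangentSpace (realModel E) x),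
    D (fun y => J y (Y y)) x v = J x (D Y x v)

/-- The curvature `R(X, Y)Z = ∇_X ∇_Y Z - ∇_Y ∇_X Z - ∇_[X,Y] Z` vanishes. -/
def IsFlatConnection (D : Connection E M) : Prop :=
  ∀ X Y Z : VField E M, IsSmooth X → IsSmooth Y → IsSmooth Z → ∀ x : M,
    D (fun y => D Z y (Y y)) x (X x) - D (fun y => D Z y (X y)) x (Y x)
      - D Z x (VectorField.mlieBracket (realModel E) X Y x) = 0

/-- The value `ω(u, v) = g(J u, v)` of the fundamental form. -/
def fundamentalForm (g : BilinField E M) (x : M) (u v : TangentSpace (realModel E) x) : ℝ :=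
  g x (J x u) v

/-- `g` is Kähler: the exterior derivative of the fundamental form vanishes. -/
def IsKahler (g : BilinField E M) : Prop :=
  ∀ X Y Z : VField E M, IsSmooth X → IsSmooth Y → IsSmooth Z → ∀ x : M,
    mvfderiv (realModel E) (fun y => fundamentalForm g y (Y y) (Z y)) x (X x)
      - mvfderiv (realModel E) (fun y => fundamentalForm g y (X y) (Z y)) x (Y x)
      + mvfderiv (realModel E) (fun y => fundamentalForm g y (X y) (Y y)) x (Z x)
      - fundamentalForm g x (VectorField.mlieBracket (realModel E) X Y x) (Z x)
      + fundamentalForm g x (VectorField.mlieBracket (realModel E) X Z x) (Y x)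
      - fundamentalForm g x (VectorField.mlieBracket (realModel E) Y Z x) (X x) = 0

variable [FiniteDimensional ℂ E]

/-- `D` is the Levi-Civita connection of `g`. -/
def IsLeviCivita (g : BilinField E M) (D : Connection E M) : Prop :=
  IsMetric g D ∧ ∀ x : M, D.torsion x = 0

/-- `g` is flat: its Levi-Civita connection has zero curvature. -/
def IsFlat (g : BilinField E M) : Prop :=
  ∃ D : Connection E M, IsLeviCivita g D ∧ IsFlatConnection D

/-- `D` is the Bismut connection of the Hermitian metric `g`: the (unique) connection with
`∇ g = 0` and `∇ J = 0` for which `(u, v, w) ↦ g(T(u, v), w)` is totally skew-symmetric. -/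
structure IsBismut (g : BilinField E M) (D : Connection E M) : Prop where
  metric : IsMetric g D
  complex : IsComplex D
  skew : ∀ (x : M) (u v w : TangentSpace (realModel E) x),
    g x (D.torsion x u v) w = - g x (D.torsion x u w) v

/-- The torsion tensor of `D` is parallel:
`∇_v (T(X, Y)) = T(∇_v X, Y) + T(X, ∇_v Y)`. -/
def HasParallelTorsion (D : Connection E M) : Prop :=
  ∀ X Y : VField E M, IsSmooth X → IsSmooth Y → ∀ (x : M) (v : TangentSpace (realModel E) x),
    D (fun y => D.torsion y (X y) (Y y)) x v
      = D.torsion x (D X x v) (Y x) + D.torsion x (X x) (D Y x v)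

/-- `g` is Bismut torsion parallel: its Bismut connection has parallel torsion. -/
def IsBTP (g : BilinField E M) : Prop :=
  ∃ D : Connection E M, IsBismut g D ∧ HasParallelTorsion D

end ComplexManifold

/-! ### Left-invariant metrics on complex Lie groups -/

section LieGroup

variable (E : Type*) [NormedAddCommGroup E] [NormedSpace ℂ E]
  (G : Type*) [TopologicalSpace G] [ChartedSpace E G] [Group G]

/-- A left-invariant Hermitian metric on a complex Lie group, as a `J`-invariant Riemannian metric
(left-invariance makes it automatically smooth). -/
structure LeftInvariantHermitianMetric where
  /-- The inner product on each tangent space. -/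
  inner : BilinField E G
  symm : ∀ (x : G) (u v : TangentSpace (realModel E) x), inner x u v = inner x v u
  pos : ∀ (x : G) (v : TangentSpace (realModel E) x), v ≠ 0 → 0 < inner x v v
  hermitian : ∀ (x : G) (u v : TangentSpace (realModel E) x),
    inner x (J x u) (J x v) = inner x u v
  left_invariant : ∀ (a x : G) (u v : TangentSpace (realModel E) x),
    inner (a * x) (mfderiv (realModel E) (realModel E) (fun y => a * y) x u)
      (mfderiv (realModel E) (realModel E) (fun y => a * y) x v) = inner x u v

variable {E G} [FiniteDimensional ℂ E] [LieGroup 𝓘(ℂ, E) ω G]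

/-- `f` preserves the (complex) Cartan-Killing form of the Lie algebra of `G`. -/
def IsBIsometry (f : GroupLieAlgebra 𝓘(ℂ, E) G ≃ₗ[ℂ] GroupLieAlgebra 𝓘(ℂ, E) G) : Prop :=
  ∀ X Y, killingForm ℂ (GroupLieAlgebra 𝓘(ℂ, E) G) (f X) (f Y)
    = killingForm ℂ (GroupLieAlgebra 𝓘(ℂ, E) G) X Y

/-- `h(X, Y) = c · g(f X, Y)` on the Lie algebra, for a constant `c > 0` and a `B`-isometry `f`. -/
def DifferByMultipleOfBIsometry (g h : LeftInvariantHermitianMetric E G) : Prop :=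
  ∃ c : ℝ, 0 < c ∧
    ∃ f : GroupLieAlgebra 𝓘(ℂ, E) G ≃ₗ[ℂ] GroupLieAlgebra 𝓘(ℂ, E) G, IsBIsometry f ∧
      ∀ X Y : GroupLieAlgebra 𝓘(ℂ, E) G,
        h.inner 1 (toReal 1 X) (toReal 1 Y) = c * g.inner 1 (toReal 1 (f X)) (toReal 1 Y)

end LieGroup

/-! ### The vector group `ℂ^k` and the product `ℂ^k × G_1 × ⋯ × G_r` -/

section Product

/-- The vector group `ℂ^k`, written multiplicatively. -/
abbrev VectorGroup (k : ℕ) : Type := Multiplicative (EuclideanSpace ℂ (Fin k))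

instance (k : ℕ) : ChartedSpace (EuclideanSpace ℂ (Fin k)) (VectorGroup k) :=
  inferInstanceAs (ChartedSpace (EuclideanSpace ℂ (Fin k)) (EuclideanSpace ℂ (Fin k)))

instance (k : ℕ) : LieGroup 𝓘(ℂ, EuclideanSpace ℂ (Fin k)) ω (VectorGroup k) where
  compatible {_ _} he he' :=
    HasGroupoid.compatible (M := EuclideanSpace ℂ (Fin k))
      (G := contDiffGroupoid ω 𝓘(ℂ, EuclideanSpace ℂ (Fin k))) he he'
  contMDiff_mul := contMDiff_add 𝓘(ℂ, EuclideanSpace ℂ (Fin k)) ω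
    (G := EuclideanSpace ℂ (Fin k))
  contMDiff_inv := contMDiff_neg 𝓘(ℂ, EuclideanSpace ℂ (Fin k)) ω
    (G := EuclideanSpace ℂ (Fin k))

variable {r : ℕ} (k : ℕ)

/-- The model space of the product. -/
abbrev ProductModel (E : Fin r → Type*) : Type _ := EuclideanSpace ℂ (Fin k) × ((i : Fin r) → E i)

/-- The group `ℂ^k × G_1 × ⋯ × G_r`. -/
def ProductGroup (G : Fin r → Type*) : Type _ := VectorGroup k × ((i : Fin r) → G i)

variable (E : Fin r → Type*) [∀ i, NormedAddCommGroup (E i)] [∀ i, NormedSpace ℂ (E i)]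
  (G : Fin r → Type*) [∀ i, TopologicalSpace (G i)] [∀ i, ChartedSpace (E i) (G i)]

instance : TopologicalSpace (ProductGroup k G) :=
  inferInstanceAs (TopologicalSpace (VectorGroup k × ((i : Fin r) → G i)))

instance [∀ i, Group (G i)] : Group (ProductGroup k G) :=
  inferInstanceAs (Group (VectorGroup k × ((i : Fin r) → G i)))

/-- The product charts. -/
instance : ChartedSpace (ProductModel k E) (ProductGroup k G) :=
  inferInstanceAs (ChartedSpace (ModelProd (EuclideanSpace ℂ (Fin k)) (ModelPi E))
    (VectorGroup k × ((i : Fin r) → G i)))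


variable {G} in
/-- The projection to the Euclidean factor. -/
def toVector (p : ProductGroup k G) : VectorGroup k := p.1

variable {G} in
/-- The projection to the factor `G i`. -/
def toFactor (i : Fin r) (p : ProductGroup k G) : G i := p.2 i

instance [∀ i, IsManifold 𝓘(ℂ, E i) ω (G i)] :
    IsManifold 𝓘(ℂ, ProductModel k E) ω (ProductGroup k G) := by
  refine isManifold_of_contDiffOn _ _ _ ?_
  rintro _ _ ⟨e₀, he₀, _, ⟨e, he, rfl⟩, rfl⟩ ⟨e₀', he₀', _, ⟨e', he', rfl⟩, rfl⟩
  have h₀ : ContDiffOn ℂ ω (e₀.symm ≫ₕ e₀') (e₀.symm ≫ₕ e₀').source := by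
    simpa [contDiffPregroupoid] using (mem_groupoid_of_pregroupoid.1 (HasGroupoid.compatible (M := VectorGroup k)
      (G := contDiffGroupoid ω 𝓘(ℂ, EuclideanSpace ℂ (Fin k))) he₀ he₀')).1
  have h (i : Fin r) : ContDiffOn ℂ ω ((e i).symm ≫ₕ e' i) ((e i).symm ≫ₕ e' i).source := by
    simpa [contDiffPregroupoid] using (mem_groupoid_of_pregroupoid.1 (HasGroupoid.compatible
      (G := contDiffGroupoid ω 𝓘(ℂ, E i)) (he i trivial) (he' i trivial))).1
  refine ContDiffOn.prodMk (f := fun q : ProductModel k E => (e₀.symm ≫ₕ e₀') q.1)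
    (g := fun q : ProductModel k E => fun i => ((e i).symm ≫ₕ e' i) (q.2 i)) ?_ ?_
  · refine h₀.comp contDiff_fst.contDiffOn ?_
    rintro q ⟨⟨hq, hq'⟩, -⟩
    exact ⟨hq.1, hq'.1⟩
  · refine contDiffOn_pi.2 fun i => ?_
    have hi : ContDiff ℂ ω fun q : ProductModel k E => q.2 i :=
      ((ContinuousLinearMap.proj (R := ℂ) (φ := E) i).comp
        (ContinuousLinearMap.snd ℂ (EuclideanSpace ℂ (Fin k)) _)).contDiff
    refine (h i).comp hi.contDiffOn ?_
    rintro q ⟨⟨hq, hq'⟩, -⟩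
    exact ⟨hq.2 i trivial, hq'.2 i trivial⟩

variable {k E G} in
/-- A map into the product is holomorphic as soon as its components are. -/
theorem contMDiff_product {F N : Type*} [NormedAddCommGroup F] [NormedSpace ℂ F]
    {H : Type*} [TopologicalSpace H] {I : ModelWithCorners ℂ F H}
    [TopologicalSpace N] [ChartedSpace H N] {f : N → ProductGroup k G}
    (h₀ : ContMDiff I 𝓘(ℂ, EuclideanSpace ℂ (Fin k)) ω (fun x => toVector k (f x)))
    (h : ∀ i, ContMDiff I 𝓘(ℂ, E i) ω (fun x => toFactor k i (f x))) :
    ContMDiff I 𝓘(ℂ, ProductModel k E) ω f := by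
  intro x
  refine contMDiffAt_iff_target.2 ⟨?_, ?_⟩
  · exact (h₀ x).continuousAt.prodMk (continuousAt_pi.2 fun i => (h i x).continuousAt)
  · refine ContMDiffAt.prodMk_space
      (f := fun y => extChartAt 𝓘(ℂ, EuclideanSpace ℂ (Fin k)) (toVector k (f x))
        (toVector k (f y)))
      (g := fun y => fun i => extChartAt 𝓘(ℂ, E i) (toFactor k i (f x)) (toFactor k i (f y)))
      (contMDiffAt_iff_target.1 (h₀ x)).2 ?_
    exact contMDiffAt_pi_space.2 fun i => (contMDiffAt_iff_target.1 (h i x)).2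

theorem contMDiff_toVector :
    ContMDiff 𝓘(ℂ, ProductModel k E) 𝓘(ℂ, EuclideanSpace ℂ (Fin k)) ω
      (toVector k : ProductGroup k G → VectorGroup k) := by
  intro p
  refine contMDiffAt_iff.2 ⟨continuous_fst.continuousAt, ?_⟩
  exact contDiff_fst.contDiffWithinAt

theorem contMDiff_toFactor (i : Fin r) :
    ContMDiff 𝓘(ℂ, ProductModel k E) 𝓘(ℂ, E i) ω
      (toFactor k i : ProductGroup k G → G i) := by
  intro p
  refine contMDiffAt_iff.2 ⟨((continuous_apply i).comp continuous_snd).continuousAt, ?_⟩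
  have hi : ContDiff ℂ ω fun q : ProductModel k E => q.2 i :=
    ((ContinuousLinearMap.proj (R := ℂ) (φ := E) i).comp
        (ContinuousLinearMap.snd ℂ (EuclideanSpace ℂ (Fin k)) _)).contDiff
  have key : ∀ q ∈ (extChartAt 𝓘(ℂ, ProductModel k E) p).target,
      (extChartAt 𝓘(ℂ, E i) (toFactor k i p) ∘ toFactor k i ∘
        (extChartAt 𝓘(ℂ, ProductModel k E) p).symm) q = q.2 i := by
    intro q hq
    have hq' : q.2 i ∈ (chartAt (E i) (p.2 i)).target := by
      rw [extChartAt_target] at hq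
      exact hq.1.2 i trivial
    exact (chartAt (E i) (p.2 i)).right_inv hq'
  refine hi.contDiffWithinAt.congr_of_eventuallyEq ?_ ?_
  · filter_upwards [extChartAt_target_mem_nhdsWithin (I := 𝓘(ℂ, ProductModel k E)) p] with q hq
    exact key q hq
  · exact key _ (mem_extChartAt_target p)

instance [∀ i, Group (G i)] [∀ i, LieGroup 𝓘(ℂ, E i) ω (G i)] :
    LieGroup 𝓘(ℂ, ProductModel k E) ω (ProductGroup k G) where
  contMDiff_mul := contMDiff_product
    (((contMDiff_toVector k E G).comp contMDiff_fst).mul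
      ((contMDiff_toVector k E G).comp contMDiff_snd))
    fun i => ((contMDiff_toFactor k E G i).comp contMDiff_fst).mul
      ((contMDiff_toFactor k E G i).comp contMDiff_snd)
  contMDiff_inv := contMDiff_product (contMDiff_toVector k E G).inv
    fun i => (contMDiff_toFactor k E G i).inv

variable {k E G} [∀ i, Group (G i)]

/-- `g` is the product metric `p₀^* g₀ + ∑ i, p_i^* g_i` of metrics on the factors, the `p`'s being
the projections of `ℂ^k × G_1 × ⋯ × G_r`. -/
def IsProductMetric
    (g : LeftInvariantHermitianMetric (ProductModel k E) (ProductGroup k G))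
    (g₀ : LeftInvariantHermitianMetric (EuclideanSpace ℂ (Fin k)) (VectorGroup k))
    (gs : (i : Fin r) → LeftInvariantHermitianMetric (E i) (G i)) : Prop :=
  ∀ (p : ProductGroup k G) (u v : TangentSpace (realModel (ProductModel k E)) p),
    g.inner p u v
      = g₀.inner (toVector k p)
          (mfderiv (realModel (ProductModel k E)) (realModel (EuclideanSpace ℂ (Fin k)))
            (toVector k) p u)
          (mfderiv (realModel (ProductModel k E)) (realModel (EuclideanSpace ℂ (Fin k)))
            (toVector k) p v)
        + ∑ i, (gs i).inner (toFactor k i p)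
            (mfderiv (realModel (ProductModel k E)) (realModel (E i)) (toFactor k i) p u)
            (mfderiv (realModel (ProductModel k E)) (realModel (E i)) (toFactor k i) p v)

end Product

end

end LieBTP

/-! Write Γ_x y for the Bismut derivative of left-invariant fields and a star for the adjoint with
respect to `g`. Since the bracket is complex bilinear, the conditions defining the Bismut connection
force Γ_x = ad x - (ad x)* (`bismut_formula`), and the torsion is T(x, y) = [x, y] - (ad x)* y + (ad
y)* x. The expression (ad x)* y is conjugate linear in x and linear in y, so the adjoint terms
cancel in T(x, y) - T(ix, iy) = 2[x, y]. Parallel torsion therefore makes Γ_v a derivation of the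
bracket, and hence also (ad v)* = ad v - Γ_v (`hasDerivationAdjoints_of_bismut`). The splitting and
the comparison of metrics use only this property, `HasDerivationAdjoints`.

Splitting: a simple factor is perfect, so every derivation preserves it. Together with its trivial
centre, this makes it orthogonal to its centralizer, which contains all other factors
(`HasDerivationAdjoints.orthogonal_centralizer`).

Comparison: derivations of a simple algebra are inner, so (ad x)* = ad (σ x) for a conjugate-linear
anti-automorphism σ with σ² = 1. By Schur's lemma g(x, y) = a Re B(y, σ x) with a > 0
(`IsAdjointInvolution.exists_eq_killingForm`). If τ belongs to a second metric, f = σ ∘ τ is the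
required isometry of B.

On ℂ^k an invariant metric has constant coefficients, hence is Kähler and flat. -/

namespace LieBTP

/-! ### Hermitian forms: adjoints, traces and orthogonal complements -/

section HermitianForm

variable {V : Type*} [AddCommGroup V] [Module ℂ V]

/-- The real part of a positive definite Hermitian form on a complex vector space. -/
structure IsHermitianForm (g : V → V → ℝ) : Prop where
  add_left : ∀ x y z, g (x + y) z = g x z + g y z
  smul_left : ∀ (c : ℝ) (x y), g ((c : ℂ) • x) y = c * g x y
  symm : ∀ x y, g x y = g y x
  pos : ∀ x, x ≠ 0 → 0 < g x x
  I_smul : ∀ x y, g (Complex.I • x) (Complex.I • y) = g x y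

namespace IsHermitianForm

variable {g : V → V → ℝ} (hg : IsHermitianForm g)
include hg

theorem add_right (x y z : V) : g x (y + z) = g x y + g x z := by
  rw [hg.symm, hg.add_left, hg.symm y, hg.symm z]

theorem neg_left (x y : V) : g (-x) y = -g x y := by
  have := hg.smul_left (-1) x y
  simpa using this

theorem neg_right (x y : V) : g x (-y) = -g x y := by
  rw [hg.symm, hg.neg_left, hg.symm]

theorem sub_left (x y z : V) : g (x - y) z = g x z - g y z := by
  rw [sub_eq_add_neg, hg.add_left, hg.neg_left, sub_eq_add_neg]

theorem sub_right (x y z : V) : g x (y - z) = g x y - g x z := by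
  rw [hg.symm, hg.sub_left, hg.symm y, hg.symm z]

theorem zero_left (y : V) : g 0 y = 0 := by
  have := hg.smul_left 0 0 y
  simpa using this

theorem I_smul_left (x y : V) : g (Complex.I • x) y = -g x (Complex.I • y) := by
  rw [← hg.I_smul x (Complex.I • y), smul_smul, Complex.I_mul_I, neg_one_smul, hg.neg_right,
    neg_neg]

theorem I_smul_self (x : V) : g x (Complex.I • x) = 0 := by
  have := hg.I_smul_left x x
  rw [hg.symm] at this
  linarith

theorem nondegenerate {x : V} (h : ∀ y, g x y = 0) : x = 0 := by
  by_contra hx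
  exact (hg.pos x hx).ne' (h x)

theorem ext_right {x y : V} (h : ∀ z, g z x = g z y) : x = y :=
  sub_eq_zero.1 <| hg.nondegenerate fun z => by rw [hg.symm, hg.sub_right, h, sub_self]

theorem smul_left_complex (c : ℂ) (x y : V) :
    g (c • x) y = c.re * g x y - c.im * g x (Complex.I • y) := by
  conv_lhs => rw [← Complex.re_add_im c, add_smul, mul_smul, hg.add_left, hg.smul_left,
    hg.smul_left, hg.I_smul_left]
  ring

omit hg in
variable (g) in
/-- The complex inner product whose real part is `g`. -/
noncomputable def hermitianInner (g : V → V → ℝ) (x y : V) : ℂ :=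
  ⟨g x y, -g x (Complex.I • y)⟩

/-- A Hermitian form makes a complex vector space into an inner product space. -/
noncomputable abbrev core : InnerProductSpace.Core ℂ V where
  inner := hermitianInner g
  conj_inner_symm x y := by
    apply Complex.ext
    · simp [hermitianInner, hg.symm x y]
    · simp [hermitianInner, hg.symm x, hg.I_smul_left]
  re_inner_nonneg x := by
    by_cases hx : x = 0
    · simp [hermitianInner, hx, hg.zero_left]
    · exact (hg.pos x hx).le
  add_left x y z := by
    apply Complex.ext
    · simp [hermitianInner, hg.add_left]
    · simp [hermitianInner, hg.add_left]; ring
  smul_left x y c := by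
    apply Complex.ext
    · simp [hermitianInner, hg.smul_left_complex]
    · simp [hermitianInner, hg.smul_left_complex, smul_smul, hg.neg_right]; ring
  definite x hx := by
    by_contra h
    exact (hg.pos x h).ne' (congrArg Complex.re hx)

omit hg in
theorem hermitianInner_adjoint {A A' : V →ₗ[ℂ] V} (h : ∀ x y, g (A x) y = g x (A' y)) (x y : V) :
    hermitianInner g (A x) y = hermitianInner g x (A' y) := by
  simp [hermitianInner, h]

theorem hermitianInner_self (x : V) : hermitianInner g x x = (g x x : ℂ) := by
  apply Complex.ext <;> simp [hermitianInner, hg.I_smul_self]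

variable [FiniteDimensional ℂ V]

theorem trace_adjoint {A A' : V →ₗ[ℂ] V} (h : ∀ x y, g (A x) y = g x (A' y)) :
    LinearMap.trace ℂ V A' = star (LinearMap.trace ℂ V A) := by
  let _ : NormedAddCommGroup V := hg.core.toNormedAddCommGroup
  let _ : InnerProductSpace ℂ V := InnerProductSpace.ofCore hg.core.toCore
  have key (x y : V) : inner ℂ (A x) y = inner ℂ x (A' y) := hermitianInner_adjoint h x y
  let b := stdOrthonormalBasis ℂ V
  rw [LinearMap.trace_eq_sum_inner A' b, LinearMap.trace_eq_sum_inner A b, star_sum]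
  refine Finset.sum_congr rfl fun i _ => ?_
  rw [← key, ← inner_conj_symm]
  rfl

/-- The trace is the squared Hilbert–Schmidt norm of `A`, the sum of the |A e|² over an orthonormal
basis. -/
theorem trace_comp_adjoint_pos {A A' : V →ₗ[ℂ] V} (h : ∀ x y, g (A x) y = g x (A' y))
    (hA : A ≠ 0) : ∃ r : ℝ, 0 < r ∧ LinearMap.trace ℂ V (A ∘ₗ A') = r := by
  let _ : NormedAddCommGroup V := hg.core.toNormedAddCommGroup
  let _ : InnerProductSpace ℂ V := InnerProductSpace.ofCore hg.core.toCore
  have key (x y : V) : inner ℂ (A x) y = inner ℂ x (A' y) := hermitianInner_adjoint h x y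
  let b := stdOrthonormalBasis ℂ V
  have hinner (x : V) : inner ℂ x x = (g x x : ℂ) := hg.hermitianInner_self x
  refine ⟨∑ i, g (A (b i)) (A (b i)), ?_, ?_⟩
  · have hnonneg (x : V) : 0 ≤ g x x := by
      by_cases hx : x = 0
      · rw [hx, hg.zero_left]
      · exact (hg.pos x hx).le
    obtain ⟨i, hi⟩ : ∃ i, A (b i) ≠ 0 := by
      by_contra! hall
      exact hA (b.toBasis.ext fun i => by simpa using hall i)
    exact Finset.sum_pos' (fun i _ => hnonneg _) ⟨i, Finset.mem_univ _, hg.pos _ hi⟩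
  · rw [← Module.End.mul_eq_comp, LinearMap.trace_mul_comm, LinearMap.trace_eq_sum_inner _ b]
    push_cast
    refine Finset.sum_congr rfl fun i _ => ?_
    rw [← hinner, Module.End.mul_apply, ← key]

theorem exists_representation (φ : V →ₗ[ℂ] ℂ) : ∃ v, ∀ y, hermitianInner g v y = φ y := by
  let _ : NormedAddCommGroup V := hg.core.toNormedAddCommGroup
  let _ : InnerProductSpace ℂ V := InnerProductSpace.ofCore hg.core.toCore
  refine ⟨(InnerProductSpace.toDual ℂ V).symm (LinearMap.toContinuousLinearMap φ), fun y => ?_⟩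
  exact InnerProductSpace.toDual_symm_apply (E := V)

theorem exists_adjoint (A : V →ₗ[ℂ] V) : ∃ A' : V →ₗ[ℂ] V, ∀ x y, g (A x) y = g x (A' y) := by
  let _ : NormedAddCommGroup V := hg.core.toNormedAddCommGroup
  let _ : InnerProductSpace ℂ V := InnerProductSpace.ofCore hg.core.toCore
  refine ⟨LinearMap.adjoint A, fun x y => ?_⟩
  exact congrArg Complex.re (LinearMap.adjoint_inner_right A x y).symm

theorem exists_orthogonal_decomposition (W : Submodule ℂ V) (x : V) :
    ∃ a ∈ W, ∃ b, x = a + b ∧ ∀ w ∈ W, g w b = 0 := by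
  let _ : NormedAddCommGroup V := hg.core.toNormedAddCommGroup
  let _ : InnerProductSpace ℂ V := InnerProductSpace.ofCore hg.core.toCore
  obtain ⟨a, ha, b, hb, rfl⟩ := W.exists_add_mem_mem_orthogonal x
  exact ⟨a, ha, b, rfl, fun w hw => congrArg Complex.re ((Submodule.mem_orthogonal W b).1 hb w hw)⟩

end IsHermitianForm

end HermitianForm

/-! ### Ideals orthogonal to their centralizers -/

section LieAlgebra

variable {L : Type*} [LieRing L] [LieAlgebra ℂ L]

/-- The adjoints of the inner derivations with respect to `g` are derivations. -/
def HasDerivationAdjoints (g : L → L → ℝ) : Prop :=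
  ∀ x : L, ∃ D : LieDerivation ℂ L L, ∀ y z : L, g ⁅x, y⁆ z = g y (D z)

/-- A perfect ideal with trivial centre is orthogonal to its centralizer. -/
theorem HasDerivationAdjoints.orthogonal_centralizer [FiniteDimensional ℂ L] {g : L → L → ℝ}
    (hg : IsHermitianForm g) (hD : HasDerivationAdjoints g) (W : Submodule ℂ L)
    (hideal : ∀ (x : L), ∀ w ∈ W, ⁅x, w⁆ ∈ W)
    (hperfect : W ≤ Submodule.span ℂ {w | ∃ a ∈ W, ∃ c ∈ W, ⁅a, c⁆ = w})
    (hcenter : ∀ a ∈ W, (∀ c ∈ W, ⁅a, c⁆ = 0) → a = 0)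
    {x : L} (hx : ∀ c ∈ W, ⁅x, c⁆ = 0) {w : L} (hw : w ∈ W) : g w x = 0 := by
  have hideal' (x : L) (w : L) (hw : w ∈ W) : ⁅w, x⁆ ∈ W := by
    rw [← lie_skew]
    exact W.neg_mem (hideal x w hw)
  -- By the Leibniz rule a derivation preserves `W`, which is spanned by brackets of its own
  -- elements.
  have hstable (D : LieDerivation ℂ L L) (w : L) (hw : w ∈ W) : D w ∈ W := by
    replace hw := hperfect hw
    induction hw using Submodule.span_induction with
    | mem w hw =>
      obtain ⟨a, ha, c, hc, rfl⟩ := hw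
      rw [D.apply_lie_eq_add]
      exact W.add_mem (hideal' _ _ ha) (hideal _ _ hc)
    | zero => simp
    | add u v _ _ hu hv => simpa using W.add_mem hu hv
    | smul c u _ hu => simpa using W.smul_mem c hu
  obtain ⟨a, ha, b, rfl, hb⟩ := hg.exists_orthogonal_decomposition W x
  -- With D = (ad c)*, |[c, b]|² = g(b, D[c, b]); here [c, b] lies in `W`, D preserves `W`, and b is
  -- orthogonal to `W`.
  have hbc (c : L) (hc : c ∈ W) : ⁅c, b⁆ = 0 := by
    obtain ⟨D, hcD⟩ := hD c
    by_contra h0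
    refine (hg.pos _ h0).ne' ?_
    rw [hcD, hg.symm]
    exact hb _ (hstable D _ (hideal' _ _ hc))
  -- Both a + b and b centralize `W`, so a lies in the centre of `W`.
  have ha0 : a = 0 := by
    refine hcenter a ha fun c hc => ?_
    have := hx c hc
    rwa [add_lie, ← lie_skew b c, hbc c hc, neg_zero, add_zero] at this
  rw [ha0, zero_add]
  exact hb w hw

end LieAlgebra

/-! ### Simple Lie algebras: the adjoint involution and Schur's lemma -/

section SimpleLieAlgebra

variable {L : Type*} [LieRing L] [LieAlgebra ℂ L] [LieAlgebra.IsSimple ℂ L]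

theorem eq_of_forall_lie_eq {u v : L} (h : ∀ z : L, ⁅u, z⁆ = ⁅v, z⁆) : u = v := by
  have : u - v ∈ LieAlgebra.center ℂ L := fun z => by
    rw [← lie_skew, sub_lie, h, sub_self, neg_zero]
  rw [LieAlgebra.center_eq_bot, LieSubmodule.mem_bot] at this
  exact sub_eq_zero.1 this

/-- The adjoint of `ad x` with respect to `g` is `ad (σ x)`. -/
def IsAdjointInvolution (g : L → L → ℝ) (σ : L → L) : Prop :=
  ∀ x y z : L, g ⁅x, y⁆ z = g y ⁅σ x, z⁆

/-- The Killing form of a simple complex Lie algebra is nondegenerate, so every derivation is inner.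
-/
theorem HasDerivationAdjoints.exists_involution [FiniteDimensional ℂ L] {g : L → L → ℝ} (hD : HasDerivationAdjoints g) :
    ∃ σ : L → L, IsAdjointInvolution g σ := by
  choose D hD using hD
  choose σ hσ using fun x => LieDerivation.IsKilling.exists_eq_ad (D x)
  refine ⟨σ, fun x y z => ?_⟩
  rw [hD, ← hσ, LieDerivation.ad_apply_apply]

namespace IsAdjointInvolution

open IsHermitianForm

variable {g : L → L → ℝ} {σ : L → L} (hg : IsHermitianForm g) (hσ : IsAdjointInvolution g σ)
include hg hσ

omit [LieAlgebra.IsSimple ℂ L] in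
theorem apply_left (x y z : L) : g ⁅σ x, y⁆ z = g y ⁅x, z⁆ := by
  rw [hg.symm, ← hσ, hg.symm]

/-- The adjoint representation is faithful, so σ x is determined by the operator (ad x)*. The rules
A** = A, (cA)* = c̄ A* and [A, B]* = [B*, A*] thereby become identities for σ. -/
theorem eq_apply {x u : L} (h : ∀ y z : L, g ⁅x, y⁆ z = g y ⁅u, z⁆) : σ x = u :=
  eq_of_forall_lie_eq fun z => hg.ext_right fun y => by rw [← hσ, h]

theorem involutive (x : L) : σ (σ x) = x :=
  hσ.eq_apply hg (hσ.apply_left hg x)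

theorem map_add (x y : L) : σ (x + y) = σ x + σ y :=
  hσ.eq_apply hg fun u v => by
    rw [add_lie, add_lie, hg.add_left, hg.add_right, hσ, hσ]

theorem map_smul (c : ℂ) (x : L) : σ (c • x) = star c • σ x := by
  refine hσ.eq_apply hg fun u v => ?_
  rw [smul_lie, smul_lie, hg.smul_left_complex, hσ, hσ, hg.symm u (star c • _),
    hg.smul_left_complex, lie_smul, hg.symm u, hg.symm _ (Complex.I • u), hg.I_smul_left u,
    hg.symm u]
  simp

theorem map_lie (x y : L) : σ ⁅x, y⁆ = ⁅σ y, σ x⁆ :=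
  hσ.eq_apply hg fun u v => by
    rw [lie_lie, lie_lie, hg.sub_left, hg.sub_right, hσ, hσ, hσ, hσ]

variable [FiniteDimensional ℂ L]

omit [LieAlgebra.IsSimple ℂ L] in
-- The adjoint of ad y ∘ ad x is ad (σ x) ∘ ad (σ y), and passing to the adjoint conjugates the
-- trace.
theorem killingForm_map (x y : L) :
    killingForm ℂ L (σ x) (σ y) = star (killingForm ℂ L x y) := by
  rw [LieModule.traceForm_comm ℂ L L x y, killingForm_apply_apply, killingForm_apply_apply]
  refine hg.trace_adjoint fun u v => ?_
  simp only [LinearMap.comp_apply, LieAlgebra.ad_apply]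
  rw [hσ, hσ]

/-- This is the trace of ad x ∘ (ad x)*, and ad x is nonzero because the centre is trivial. -/
theorem exists_killingForm_self (x : L) (hx : x ≠ 0) :
    ∃ r : ℝ, 0 < r ∧ killingForm ℂ L x (σ x) = r := by
  rw [killingForm_apply_apply]
  refine hg.trace_comp_adjoint_pos (fun u v => hσ x u v) fun h => hx ?_
  refine eq_of_forall_lie_eq fun z => ?_
  rw [zero_lie]
  exact LinearMap.congr_fun h z

/-- Schur's lemma: up to a positive constant, `g` is the Hermitian form `B(·, σ ·)`. -/
theorem exists_eq_killingForm :
    ∃ c : ℝ, 0 < c ∧ ∀ x y, g x y = c * (killingForm ℂ L y (σ x)).re := by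
  -- The operator `Q` compares B(·, σ ·) with the complex inner product. It is complex linear
  -- because σ and the first slot of the inner product are both conjugate linear.
  choose Q hQ using fun x => hg.exists_representation ((killingForm ℂ L).flip (σ x))
  replace hQ (x y : L) : hermitianInner g (Q x) y = killingForm ℂ L y (σ x) := hQ x y
  have hQre (x y : L) : g (Q x) y = (killingForm ℂ L y (σ x)).re := by rw [← hQ]; rfl
  have hext {u v : L} (h : ∀ z, g u z = g v z) : u = v :=
    hg.ext_right fun z => by rw [hg.symm, h, hg.symm]
  let P : L →ₗ[ℂ] L :=
    { toFun := Q
      map_add' := fun x y => hext fun z => by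
        rw [hg.add_left, hQre, hQre, hQre, hσ.map_add hg, _root_.map_add, Complex.add_re]
      map_smul' := fun c x => hext fun z => by
        rw [RingHom.id_apply, hg.smul_left_complex, hQre, hQre, hQre, hσ.map_smul hg,
          _root_.map_smul, _root_.map_smul, LinearMap.smul_apply]
        simp }
  -- Invariance of the Killing form and (ad z)* = ad (σ z) make `P` commute with the adjoint
  -- representation.
  have hcomm (z x : L) : P ⁅z, x⁆ = ⁅z, P x⁆ := hext fun y => by
    change g (Q _) y = g ⁅z, Q x⁆ y
    rw [hσ, hQre, hQre, hσ.map_lie hg, LieModule.traceForm_apply_lie_apply', ← _root_.map_neg,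
      lie_skew]
  have := LieAlgebra.IsSimple.non_abelian (R := ℂ) (L := L)
  have : Nontrivial L := by
    by_contra! h
    exact this ⟨fun x y => Subsingleton.elim _ _⟩
  obtain ⟨μ, hμ⟩ := Module.End.exists_eigenvalue P
  -- An eigenspace of `P` is then a nonzero ideal, hence everything, and `P` is the scalar μ.
  let I : LieIdeal ℂ L :=
    { Module.End.eigenspace P μ with
      lie_mem := fun {z x} hx => by
        change _ ∈ Module.End.eigenspace P μ
        replace hx : x ∈ Module.End.eigenspace P μ := hx
        rw [Module.End.mem_eigenspace_iff] at hx ⊢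
        rw [hcomm, hx, lie_smul] }
  have hI : I = ⊤ := by
    refine (LieAlgebra.IsSimple.eq_bot_or_eq_top I).resolve_left fun h => ?_
    obtain ⟨v, hv⟩ := hμ.exists_hasEigenvector
    have hv' : v ∈ I := hv.1
    rw [h, LieSubmodule.mem_bot] at hv'
    exact hv.2 hv'
  have hP (x : L) : Q x = μ • x := by
    have : x ∈ I := hI ▸ LieSubmodule.mem_top x
    exact Module.End.mem_eigenspace_iff.1 this
  obtain ⟨x₀, hx₀⟩ := exists_ne (0 : L)
  -- Pairing `P x₀` with `x₀` gives B(x₀, σ x₀) > 0, which shows that μ is real and positive.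
  obtain ⟨r, hr, hrx⟩ := hσ.exists_killingForm_self hg x₀ hx₀
  have hpos := hg.pos x₀ hx₀
  have hμre : μ.re * g x₀ x₀ = r := by
    have := hQre x₀ x₀
    rwa [hP, hg.smul_left_complex, hg.I_smul_self, hrx, mul_zero, sub_zero,
      Complex.ofReal_re] at this
  have hμim : μ.im * g x₀ x₀ = 0 := by
    have := congrArg Complex.im (hQ x₀ x₀)
    simp only [hrx, Complex.ofReal_im, hermitianInner, hP, hg.smul_left_complex, hg.I_smul_self,
      smul_smul, Complex.I_mul_I, neg_one_smul, hg.neg_right] at this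
    linarith
  have hμim' : μ.im = 0 := (mul_eq_zero.1 hμim).resolve_right hpos.ne'
  have hμpos : 0 < μ.re := by
    by_contra! h
    nlinarith
  refine ⟨μ.re⁻¹, inv_pos.2 hμpos, fun x y => ?_⟩
  rw [← hQre, hP, hg.smul_left_complex, hμim']
  field_simp
  ring

end IsAdjointInvolution

/-- Two Hermitian forms for which adjoints of inner derivations are derivations differ by a
multiple of an isometry of the Killing form. -/
theorem HasDerivationAdjoints.exists_isometry [FiniteDimensional ℂ L] {g h : L → L → ℝ} (hg : IsHermitianForm g)
    (hh : IsHermitianForm h) (hDg : HasDerivationAdjoints g) (hDh : HasDerivationAdjoints h) :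
    ∃ c : ℝ, 0 < c ∧ ∃ f : L ≃ₗ[ℂ] L,
      (∀ x y, killingForm ℂ L (f x) (f y) = killingForm ℂ L x y) ∧
      ∀ x y, h x y = c * g (f x) y := by
  obtain ⟨σ, hσ⟩ := hDg.exists_involution
  obtain ⟨τ, hτ⟩ := hDh.exists_involution
  obtain ⟨a, ha, hga⟩ := hσ.exists_eq_killingForm hg
  obtain ⟨b, hb, hhb⟩ := hτ.exists_eq_killingForm hh
  -- Since τ x = σ(σ τ x), the form b Re B(y, τ x) equals (b / a) g(σ τ x, y). Each involution
  -- conjugates both scalars and B, so the composite is complex linear and preserves B.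
  let f : L ≃ₗ[ℂ] L :=
    { toFun := fun x => σ (τ x)
      invFun := fun x => τ (σ x)
      map_add' := fun x y => by rw [hτ.map_add hh, hσ.map_add hg]
      map_smul' := fun c x => by
        rw [hτ.map_smul hh, hσ.map_smul hg, star_star, RingHom.id_apply]
      left_inv := fun x => by simp only [hσ.involutive hg, hτ.involutive hh]
      right_inv := fun x => by simp only [hσ.involutive hg, hτ.involutive hh] }
  refine ⟨b / a, div_pos hb ha, f, fun x y => ?_, fun x y => ?_⟩
  · change killingForm ℂ L (σ (τ x)) (σ (τ y)) = _
    rw [hσ.killingForm_map hg, hτ.killingForm_map hh, star_star]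
  · change _ = _ * g (σ (τ x)) y
    rw [hhb, hga, hσ.involutive hg]
    field_simp

end SimpleLieAlgebra

/-! ### Lie brackets in charts, over ℝ and over ℂ -/

section ChartBracket

open VectorField

variable {𝕜 : Type*} [NontriviallyNormedField 𝕜] {E : Type*} [NormedAddCommGroup E]
  [NormedSpace 𝕜 E] {M : Type*} [TopologicalSpace M] [ChartedSpace E M]

/-- A vector field read in the chart at `x₀`. -/
noncomputable def chartField (𝕜 : Type*) [NontriviallyNormedField 𝕜] {E : Type*}
    [NormedAddCommGroup E] [NormedSpace 𝕜 E] {M : Type*} [TopologicalSpace M] [ChartedSpace E M]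
    (V : (x : M) → TangentSpace 𝓘(𝕜, E) x) (x₀ : M) (q : E) : E :=
  mfderiv 𝓘(𝕜, E) 𝓘(𝕜, E) (extChartAt 𝓘(𝕜, E) x₀) ((extChartAt 𝓘(𝕜, E) x₀).symm q)
    (V ((extChartAt 𝓘(𝕜, E) x₀).symm q))

theorem mpullbackWithin_extChartAt_symm_eq_chartField [IsManifold 𝓘(𝕜, E) 1 M]
    (V : (x : M) → TangentSpace 𝓘(𝕜, E) x)
    (x₀ : M) {q : E} (hq : q ∈ (extChartAt 𝓘(𝕜, E) x₀).target) :
    mpullbackWithin 𝓘(𝕜, E) 𝓘(𝕜, E) (extChartAt 𝓘(𝕜, E) x₀).symm V (Set.range 𝓘(𝕜, E)) q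
      = chartField 𝕜 V x₀ q := by
  rw [mpullbackWithin_apply, ContinuousLinearMap.inverse_eq
    (mfderivWithin_extChartAt_symm_comp_mfderiv_extChartAt hq)
    (mfderiv_extChartAt_comp_mfderivWithin_extChartAt_symm hq)]
  rfl

theorem mpullbackWithin_eventuallyEq_chartField [IsManifold 𝓘(𝕜, E) 1 M]
    (V : (x : M) → TangentSpace 𝓘(𝕜, E) x) (x₀ : M) :
    mpullbackWithin 𝓘(𝕜, E) 𝓘(𝕜, E) (extChartAt 𝓘(𝕜, E) x₀).symm V (Set.range 𝓘(𝕜, E))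
      =ᶠ[nhds (extChartAt 𝓘(𝕜, E) x₀ x₀)] chartField 𝕜 V x₀ := by
  filter_upwards [extChartAt_target_mem_nhds (I := 𝓘(𝕜, E)) x₀] with q hq
  exact mpullbackWithin_extChartAt_symm_eq_chartField V x₀ hq

theorem mlieBracket_eq_lieBracket_chartField [IsManifold 𝓘(𝕜, E) 2 M]
    (V W : (x : M) → TangentSpace 𝓘(𝕜, E) x) (x₀ : M) :
    mlieBracket 𝓘(𝕜, E) V W x₀
      = lieBracket 𝕜 (chartField 𝕜 V x₀) (chartField 𝕜 W x₀) (extChartAt 𝓘(𝕜, E) x₀ x₀) := by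
  have : IsManifold 𝓘(𝕜, E) 1 M := IsManifold.of_le (n := 2) one_le_two
  -- The derivative of the preferred chart at its own base point is the identity, so the outer
  -- pullback has no effect.
  have hinv (A : E →L[𝕜] E) (hA : A = ContinuousLinearMap.id 𝕜 E) (w : E) : A.inverse w = w := by
    rw [hA, ContinuousLinearMap.inverse_id, ContinuousLinearMap.id_apply]
  rw [← mlieBracketWithin_univ, mlieBracketWithin_apply]
  refine (hinv _ mfderiv_extChartAt_self _).trans ?_
  simp only [modelWithCornersSelf_coe, Set.range_id, Set.preimage_univ, Set.univ_inter]
  have hV := mpullbackWithin_eventuallyEq_chartField V x₀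
  have hW := mpullbackWithin_eventuallyEq_chartField W x₀
  simp only [modelWithCornersSelf_coe, Set.range_id] at hV hW
  exact (congrFun lieBracketWithin_univ _).trans (hV.lieBracket_vectorField_eq hW)

theorem differentiableAt_chartField [CompleteSpace E] [IsManifold 𝓘(𝕜, E) 2 M]
    {V : (x : M) → TangentSpace 𝓘(𝕜, E) x} {x₀ : M}
    (hV : MDifferentiableAt 𝓘(𝕜, E) 𝓘(𝕜, E).tangent
      (fun x => (⟨x, V x⟩ : TangentBundle 𝓘(𝕜, E) M)) x₀) :
    DifferentiableAt 𝕜 (chartField 𝕜 V x₀) (extChartAt 𝓘(𝕜, E) x₀ x₀) := by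
  have : IsManifold 𝓘(𝕜, E) 1 M := IsManifold.of_le (n := 2) one_le_two
  have h := (mdifferentiableWithinAt_univ.2
    hV).differentiableWithinAt_mpullbackWithin_vectorField
  simp only [modelWithCornersSelf_coe, Set.preimage_univ, Set.univ_inter, Set.range_id] at h
  have hV := mpullbackWithin_eventuallyEq_chartField V x₀
  simp only [modelWithCornersSelf_coe, Set.range_id] at hV
  exact (differentiableWithinAt_univ.1 h).congr_of_eventuallyEq hV.symm

end ChartBracket

section InvariantFields

open VectorField Bundle

variable {𝕜 : Type*} [NontriviallyNormedField 𝕜] {H : Type*} [TopologicalSpace H] {E : Type*}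
  [NormedAddCommGroup E] [NormedSpace 𝕜 E] {I : ModelWithCorners 𝕜 E H}
  {G : Type*} [TopologicalSpace G] [ChartedSpace H G] [Group G] [LieGroup I ω G]

/-- The left-invariant field is g ↦ dm(0_g, v), where m is the multiplication, and so a composite of
smooth maps. -/
theorem contMDiff_mulInvariantVectorField_top (v : GroupLieAlgebra I G) :
    ContMDiff I I.tangent ∞
      (fun g : G => (⟨g, mulInvariantVectorField v g⟩ : TangentBundle I G)) := by
  have : LieGroup I ∞ G := LieGroup.of_le (n := ω) le_top
  have : IsManifold I ∞ G := IsManifold.of_le (n := ω) le_top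
  let fg : G → TangentBundle I G := fun g => TotalSpace.mk' E g 0
  have sfg : ContMDiff I I.tangent ∞ fg := contMDiff_zeroSection _ _
  let fv : G → TangentBundle I G := fun _ => TotalSpace.mk' E 1 v
  have sfv : ContMDiff I I.tangent ∞ fv := contMDiff_const
  let F₁ : G → (TangentBundle I G × TangentBundle I G) := fun g => (fg g, fv g)
  have S₁ : ContMDiff I (I.tangent.prod I.tangent) ∞ F₁ := sfg.prodMk sfv
  let F₂ : (TangentBundle I G × TangentBundle I G) → TangentBundle (I.prod I) (G × G) :=
    (equivTangentBundleProd I G I G).symm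
  have S₂ : ContMDiff (I.tangent.prod I.tangent) (I.prod I).tangent ∞ F₂ :=
    contMDiff_equivTangentBundleProd_symm
  let F₃ : TangentBundle (I.prod I) (G × G) → TangentBundle I G :=
    tangentMap (I.prod I) I (fun p : G × G => p.1 * p.2)
  have S₃ : ContMDiff (I.prod I).tangent I.tangent ∞ F₃ :=
    (contMDiff_mul I ∞).contMDiff_tangentMap (m := ∞) le_rfl
  have S := (S₃.comp S₂).comp S₁
  convert! S with g
  · simp [F₁, F₂, F₃, fg, fv]
  · simp only [Function.comp_apply, tangentMap, F₃, F₂, F₁, fg, fv]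
    rw [mfderiv_prod_eq_add_apply ((contMDiff_mul I ∞).mdifferentiableAt (by simp))]
    have hzero (A : E →L[𝕜] E) (w : E) : w = A 0 + w := by simp
    exact hzero _ _

end InvariantFields

section RestrictScalars

variable {E F : Type*} [NormedAddCommGroup E] [NormedSpace ℂ E] [NormedAddCommGroup F]
  [NormedSpace ℂ F] {M N : Type*} [TopologicalSpace M] [ChartedSpace E M]
  [TopologicalSpace N] [ChartedSpace F N]

theorem hasMFDerivAt_restrictScalars {f : M → N} {x : M} {f' : E →L[ℂ] F}
    (h : HasMFDerivAt 𝓘(ℂ, E) 𝓘(ℂ, F) f x f') :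
    HasMFDerivAt (realModel E) (realModel F) f x (f'.restrictScalars ℝ : E →L[ℝ] F) :=
  ⟨h.1, HasFDerivWithinAt.restrictScalars ℝ h.2⟩

theorem mdifferentiableAt_restrictScalars {f : M → N} {x : M}
    (h : MDifferentiableAt 𝓘(ℂ, E) 𝓘(ℂ, F) f x) :
    MDifferentiableAt (realModel E) (realModel F) f x :=
  (hasMFDerivAt_restrictScalars h.hasMFDerivAt).mdifferentiableAt

theorem mfderiv_restrictScalars {f : M → N} {x : M}
    (h : MDifferentiableAt 𝓘(ℂ, E) 𝓘(ℂ, F) f x) (v : TangentSpace 𝓘(ℂ, E) x) :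
    mfderiv (realModel E) (realModel F) f x (toReal x v)
      = toReal (f x) (mfderiv 𝓘(ℂ, E) 𝓘(ℂ, F) f x v) := by
  rw [(hasMFDerivAt_restrictScalars h.hasMFDerivAt).mfderiv]
  rfl

theorem contMDiff_restrictScalars {f : M → N} {n : ℕ∞ω}
    (h : ContMDiff 𝓘(ℂ, E) 𝓘(ℂ, F) n f) : ContMDiff (realModel E) (realModel F) n f :=
  fun x => ⟨(h x).1, ContDiffWithinAt.restrict_scalars ℝ (h x).2⟩

theorem contMDiff_prod_restrictScalars {f : M × M → N} {n : ℕ∞ω}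
    (h : ContMDiff (𝓘(ℂ, E).prod 𝓘(ℂ, E)) 𝓘(ℂ, F) n f) :
    ContMDiff ((realModel E).prod (realModel E)) (realModel F) n f :=
  fun x => ⟨(h x).1, ContDiffWithinAt.restrict_scalars ℝ (h x).2⟩

instance lieGroup_real {G : Type*} [TopologicalSpace G] [ChartedSpace E G] [Group G]
    [LieGroup 𝓘(ℂ, E) ω G] : LieGroup (realModel E) ω G where
  contMDiff_mul := contMDiff_prod_restrictScalars (contMDiff_mul 𝓘(ℂ, E) ω)
  contMDiff_inv := contMDiff_restrictScalars (contMDiff_inv 𝓘(ℂ, E) ω)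

end RestrictScalars

instance {E : Type*} [NormedAddCommGroup E] [NormedSpace ℂ E] [FiniteDimensional ℂ E]
    {M : Type*} [TopologicalSpace M] [ChartedSpace E M] (x : M) :
    FiniteDimensional ℂ (TangentSpace 𝓘(ℂ, E) x) :=
  inferInstanceAs (FiniteDimensional ℂ E)

section RealBracket

open VectorField

variable {E : Type*} [NormedAddCommGroup E] [NormedSpace ℂ E]
  {M : Type*} [TopologicalSpace M] [ChartedSpace E M] [IsManifold 𝓘(ℂ, E) ω M]

theorem chartField_real_eventuallyEq (V : (x : M) → TangentSpace 𝓘(ℂ, E) x) (x₀ : M) :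
    chartField ℝ (fun x => toReal x (V x)) x₀
      =ᶠ[nhds (extChartAt 𝓘(ℂ, E) x₀ x₀)] chartField ℂ V x₀ := by
  have : IsManifold 𝓘(ℂ, E) 1 M := IsManifold.of_le (n := ω) le_top
  filter_upwards [extChartAt_target_mem_nhds (I := 𝓘(ℂ, E)) x₀] with q hq
  refine mfderiv_restrictScalars (mdifferentiableAt_extChartAt ?_) _
  have := (extChartAt 𝓘(ℂ, E) x₀).map_target hq
  rwa [extChartAt_source] at this

/-- The Lie algebra carries the complex bracket while torsion uses the real one. They agree in a
chart because the complex derivative, restricted to real scalars, is the real derivative. -/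
theorem mlieBracket_real [CompleteSpace E] {V W : (x : M) → TangentSpace 𝓘(ℂ, E) x} {x₀ : M}
    (hV : MDifferentiableAt 𝓘(ℂ, E) 𝓘(ℂ, E).tangent
      (fun x => (⟨x, V x⟩ : TangentBundle 𝓘(ℂ, E) M)) x₀)
    (hW : MDifferentiableAt 𝓘(ℂ, E) 𝓘(ℂ, E).tangent
      (fun x => (⟨x, W x⟩ : TangentBundle 𝓘(ℂ, E) M)) x₀) :
    mlieBracket (realModel E) (fun x => toReal x (V x)) (fun x => toReal x (W x)) x₀
      = toReal x₀ (mlieBracket 𝓘(ℂ, E) V W x₀) := by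
  have : IsManifold 𝓘(ℂ, E) 2 M := IsManifold.of_le (n := ω) le_top
  have : IsManifold (realModel E) 2 M := IsManifold.of_le (n := ω) le_top
  rw [mlieBracket_eq_lieBracket_chartField, mlieBracket_eq_lieBracket_chartField]
  refine ((chartField_real_eventuallyEq V x₀).lieBracket_vectorField_eq
    (chartField_real_eventuallyEq W x₀)).trans ?_
  have h₁ := (differentiableAt_chartField hV).fderiv_restrictScalars ℝ
  have h₂ := (differentiableAt_chartField hW).fderiv_restrictScalars ℝ
  simp only [lieBracket, toReal]
  rw [h₁, h₂]
  rfl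

end RealBracket

/-! ### Left-invariant fields and metrics -/

section LeftInvariantFields

open VectorField

variable {E : Type*} [NormedAddCommGroup E] [NormedSpace ℂ E]
  {G : Type*} [TopologicalSpace G] [ChartedSpace E G] [Group G] [LieGroup 𝓘(ℂ, E) ω G]

/-- The left-invariant vector field on the underlying real manifold with given value at `1`. -/
noncomputable def leftField (v : GroupLieAlgebra 𝓘(ℂ, E) G) : VField E G :=
  fun x => toReal x (mulInvariantVectorField v x)

theorem mdifferentiableAt_mul_left (a x : G) :
    MDifferentiableAt 𝓘(ℂ, E) 𝓘(ℂ, E) (fun y => a * y) x :=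
  (contMDiff_mul_left (n := ω)).mdifferentiable (by simp) x

theorem leftField_eq_mfderiv (v : GroupLieAlgebra 𝓘(ℂ, E) G) (x : G) :
    leftField v x = mfderiv (realModel E) (realModel E) (fun y => x * y) 1 (toReal 1 v) :=
  (mfderiv_restrictScalars (mdifferentiableAt_mul_left x 1) v).symm

theorem isSmooth_leftField (v : GroupLieAlgebra 𝓘(ℂ, E) G) : IsSmooth (leftField v) := by
  have h := contMDiff_mulInvariantVectorField_top (I := realModel E) (G := G) (toReal 1 v)
  have heq : (fun x => (⟨x, leftField v x⟩ : TangentBundle (realModel E) G))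
      = fun x => ⟨x, mulInvariantVectorField (toReal 1 v) x⟩ := by
    ext1 x
    rw [leftField_eq_mfderiv]
    rfl
  rw [IsSmooth, heq]
  exact h

theorem leftField_one (v : GroupLieAlgebra 𝓘(ℂ, E) G) : leftField v 1 = toReal 1 v := by
  have h : (fun y : G => 1 * y) = id := funext one_mul
  rw [leftField_eq_mfderiv]
  have h' : mfderiv (realModel E) (realModel E) (fun y : G => 1 * y) 1
      = (ContinuousLinearMap.id ℝ E : E →L[ℝ] E) := by
    rw [h]
    exact mfderiv_id
  exact congrArg (fun A : E →L[ℝ] E => A v) h'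

omit [LieGroup 𝓘(ℂ, E) ω G] in
theorem leftField_add (v w : GroupLieAlgebra 𝓘(ℂ, E) G) (x : G) :
    leftField (v + w) x = leftField v x + leftField w x :=
  congrFun (mulInvariantVectorField_add v w) x

omit [LieGroup 𝓘(ℂ, E) ω G] in
theorem leftField_smul (c : ℂ) (v : GroupLieAlgebra 𝓘(ℂ, E) G) (x : G) :
    leftField (c • v) x = toReal x (c • mulInvariantVectorField v x) :=
  congrFun (mulInvariantVectorField_smul c v) x

omit [LieGroup 𝓘(ℂ, E) ω G] in
theorem leftField_I_smul (v : GroupLieAlgebra 𝓘(ℂ, E) G) (x : G) :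
    leftField (Complex.I • v) x = J x (leftField v x) := 
  leftField_smul _ v x

theorem leftField_surjective (x : G) (u : TangentSpace (realModel E) x) :
    ∃ v : GroupLieAlgebra 𝓘(ℂ, E) G, leftField v x = u := by
  let v : GroupLieAlgebra 𝓘(ℂ, E) G :=
    (mfderiv (realModel E) (realModel E) (fun y => x⁻¹ * y) x u : E)
  refine ⟨v, ?_⟩
  have hmul (a y : G) := mdifferentiableAt_restrictScalars (mdifferentiableAt_mul_left (E := E) a y)
  have h : mfderiv (realModel E) (realModel E) ((fun y => x * y) ∘ fun y => x⁻¹ * y) x u = _ :=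
    mfderiv_comp_apply_of_eq x (hmul x 1) (hmul x⁻¹ x) (inv_mul_cancel x) u
  have hid : (fun y => x * y) ∘ (fun y => x⁻¹ * y) = id := by
    ext y
    simp
  rw [hid, mfderiv_id] at h
  rw [leftField_eq_mfderiv]
  exact h.symm

theorem mlieBracket_leftField [CompleteSpace E] (v w : GroupLieAlgebra 𝓘(ℂ, E) G) :
    mlieBracket (realModel E) (leftField v) (leftField w) = leftField ⁅v, w⁆ := by
  have : LieGroup 𝓘(ℂ, E) (minSmoothness ℂ 3) G := inferInstance
  ext x
  refine (mlieBracket_real (mdifferentiableAt_mulInvariantVectorField v)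
    (mdifferentiableAt_mulInvariantVectorField w)).trans ?_
  rw [← mulInvariantVector_mlieBracket]
  rfl

theorem inner_leftField (g : LeftInvariantHermitianMetric E G) (x : G)
    (v w : GroupLieAlgebra 𝓘(ℂ, E) G) :
    g.inner x (leftField v x) (leftField w x) = g.inner 1 (toReal 1 v) (toReal 1 w) := by
  rw [leftField_eq_mfderiv, leftField_eq_mfderiv, ← g.left_invariant x 1]
  -- The tangent spaces at `x * 1` and `x` are different types, so the base point is rewritten with
  -- vectors taken in the model space.
  have h (y : G) (hy : y = x) (a b : E) : g.inner x a b = g.inner y a b := by rw [hy]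
  exact h _ (mul_one x) _ _

/-- The inner product on the Lie algebra defined by a left-invariant metric. -/
noncomputable def innerOne (g : LeftInvariantHermitianMetric E G) (X Y : GroupLieAlgebra 𝓘(ℂ, E) G) : ℝ :=
  g.inner 1 (toReal 1 X) (toReal 1 Y)

omit [LieGroup 𝓘(ℂ, E) ω G] in
theorem isHermitianForm_innerOne (g : LeftInvariantHermitianMetric E G) :
    IsHermitianForm (innerOne g) where
  add_left x y z := by
    have h (B : E →L[ℝ] E →L[ℝ] ℝ) (x y z : E) : B (x + y) z = B x z + B y z := by simp
    exact h _ x y z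
  smul_left c x y := by
    have h (B : E →L[ℝ] E →L[ℝ] ℝ) (x y : E) : B ((c : ℂ) • x) y = c * B x y := by
      simp [Complex.coe_smul]
    exact h _ x y
  symm x y := g.symm 1 _ _
  pos x hx := g.pos 1 _ hx
  I_smul x y := g.hermitian 1 _ _

end LeftInvariantFields

/-! ### The Bismut connection on the Lie algebra -/

section Bismut

variable {L : Type*} [LieRing L] [LieAlgebra ℂ L] {g : L → L → ℝ}

/-- The difference Δ of the two sides is skew in its last two slots by metricity and cyclically
invariant by skewness of the torsion. It is also invariant under applying i to the last two slots.
Moving i around the three slots then gives Δ = -Δ. -/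
theorem bismut_formula (hg : IsHermitianForm g) {Γ : L → L → L}
    (hmetric : ∀ x y z, g (Γ x y) z + g y (Γ x z) = 0)
    (hcomplex : ∀ x y, Γ x (Complex.I • y) = Complex.I • Γ x y)
    (hskew : ∀ x y z, g (Γ x y - Γ y x - ⁅x, y⁆) z = -g (Γ x z - Γ z x - ⁅x, z⁆) y) (x y z : L) :
    g (Γ x y) z = g ⁅x, y⁆ z - g ⁅x, z⁆ y := by
  let Δ (x y z : L) : ℝ := g (Γ x y) z - g ⁅x, y⁆ z + g ⁅x, z⁆ y
  have hswap (x y z : L) : Δ x z y = -Δ x y z := by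
    have := hmetric x y z
    rw [hg.symm y] at this
    simp only [Δ]
    linarith
  have hcyc (x y z : L) : Δ y x z = -Δ z x y := by
    have h₁ := hskew x y z
    have h₂ := hmetric x y z
    rw [hg.symm y] at h₂
    simp only [Δ, hg.sub_left] at h₁ ⊢
    rw [← lie_skew y x, ← lie_skew z x, ← lie_skew z y, hg.neg_left, hg.neg_left, hg.neg_left]
    linarith
  have hI (x y z : L) : Δ x (Complex.I • y) (Complex.I • z) = Δ x y z := by
    simp only [Δ, hcomplex, lie_smul, hg.I_smul]
  -- `Γ` is not assumed additive; the sign comes from -1 = i².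
  have hneg (x y z : L) : Δ x (-y) z = -Δ x y z := by
    have : Γ x (-y) = -Γ x y := by
      have h : -y = Complex.I • Complex.I • y := by
        rw [smul_smul, Complex.I_mul_I, neg_one_smul]
      rw [h, hcomplex, hcomplex, smul_smul, Complex.I_mul_I, neg_one_smul]
    simp only [Δ, this, lie_neg, hg.neg_left, hg.neg_right]
    ring
  have hrot (x y z : L) : Δ x y z = Δ y z x := by
    linarith [hcyc y x z, hswap z x y, hcyc x z y, hswap y x z]
  have h : Δ x y z = -Δ x y z := by
    calc Δ x y z = Δ x (Complex.I • y) (Complex.I • z) := (hI x y z).symm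
      _ = Δ (Complex.I • y) (Complex.I • z) x := hrot _ _ _
      _ = Δ (Complex.I • y) (Complex.I • Complex.I • z) (Complex.I • x) := (hI _ _ _).symm
      _ = -Δ (Complex.I • y) z (Complex.I • x) := by
        rw [smul_smul, Complex.I_mul_I, neg_one_smul, hneg]
      _ = -Δ z (Complex.I • x) (Complex.I • y) := by rw [hrot]
      _ = -Δ x y z := by rw [hI, hrot]
  simp only [Δ] at h
  linarith

theorem hasDerivationAdjoints_of_bismut [FiniteDimensional ℂ L] (hg : IsHermitianForm g)
    {Γ T : L → L → L}
    (hmetric : ∀ x y z, g (Γ x y) z + g y (Γ x z) = 0)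
    (hcomplex : ∀ x y, Γ x (Complex.I • y) = Complex.I • Γ x y)
    (hT : ∀ x y, T x y = Γ x y - Γ y x - ⁅x, y⁆)
    (hskew : ∀ x y z, g (T x y) z = -g (T x z) y)
    (hparallel : ∀ v x y, Γ v (T x y) = T (Γ v x) y + T x (Γ v y)) :
    HasDerivationAdjoints g := by
  choose D hD using fun x : L => hg.exists_adjoint (LieAlgebra.ad ℂ L x : L →ₗ[ℂ] L)
  simp only [LieAlgebra.ad_apply] at hD
  have hΓ (x y : L) : Γ x y = ⁅x, y⁆ - D x y := by
    refine hg.ext_right fun z => ?_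
    rw [hg.sub_right, hg.symm z, hg.symm z,
      bismut_formula hg hmetric hcomplex (by simpa only [hT] using hskew), hD x z, hg.symm z]
  have hDI (x y : L) : D (Complex.I • x) y = -Complex.I • D x y := by
    refine hg.ext_right fun z => ?_
    rw [← hD, smul_lie, hg.I_smul_left, hD, _root_.map_smul, neg_smul, hg.neg_right]
  have hT' (x y : L) : T x y = ⁅x, y⁆ - D x y + D y x := by
    rw [hT, hΓ, hΓ, ← lie_skew x y]
    abel
  -- Replacing (x, y) by (ix, iy) fixes (ad x)* y and (ad y)* x and changes the sign of [x, y].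
  have hlie (x y : L) : (2 : ℂ) • ⁅x, y⁆ = T x y - T (Complex.I • x) (Complex.I • y) := by
    rw [hT', hT', hDI, hDI, _root_.map_smul, _root_.map_smul, smul_lie, lie_smul, smul_smul,
      smul_smul, smul_smul, Complex.I_mul_I, neg_mul, Complex.I_mul_I]
    module
  -- `Γ v` satisfies the Leibniz rule for `T` and commutes with i, so it satisfies it for 2[·, ·].
  have hder (v x y : L) : Γ v ⁅x, y⁆ = ⁅Γ v x, y⁆ + ⁅x, Γ v y⁆ := by
    have h2 : (2 : ℂ) • Γ v ⁅x, y⁆ = (2 : ℂ) • (⁅Γ v x, y⁆ + ⁅x, Γ v y⁆) := by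
      rw [smul_add, hlie, hlie]
      have hlin : (2 : ℂ) • Γ v ⁅x, y⁆
          = Γ v (T x y) - Γ v (T (Complex.I • x) (Complex.I • y)) := by
        rw [hΓ, hΓ, hΓ, smul_sub, ← lie_smul, ← _root_.map_smul, hlie, lie_sub, map_sub]
        abel
      rw [hlin, hparallel, hparallel, hcomplex, hcomplex]
      abel
    exact smul_right_injective L (two_ne_zero (α := ℂ)) h2
  intro v
  refine ⟨⟨D v, fun a b => ?_⟩, fun y z => hD v y z⟩
  have hDΓ (z : L) : D v z = ⁅v, z⁆ - Γ v z := by rw [hΓ]; abel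
  rw [hDΓ, hDΓ, hDΓ, hder, leibniz_lie, lie_sub, lie_sub, ← lie_skew a ⁅v, b⁆, ← lie_skew b ⁅v, a⁆,
    ← lie_skew b (Γ v a), ← lie_skew ⁅v, b⁆ a]
  abel

end Bismut

section BTP

variable {E : Type*} [NormedAddCommGroup E] [NormedSpace ℂ E] [FiniteDimensional ℂ E]
  {G : Type*} [TopologicalSpace G] [ChartedSpace E G] [Group G] [LieGroup 𝓘(ℂ, E) ω G]

/-- The given connection is not assumed left-invariant. Its coefficients `Γ x` in the left-invariant
frame a priori depend on the point, and `bismut_formula` shows that they do not. -/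
theorem hasDerivationAdjoints_of_isBTP (g : LeftInvariantHermitianMetric E G)
    (hg : IsBTP g.inner) : HasDerivationAdjoints (innerOne g) := by
  obtain ⟨D, hD, hpar⟩ := hg
  have hform := isHermitianForm_innerOne g
  choose Γ hΓ using fun (x : G) (v w : GroupLieAlgebra 𝓘(ℂ, E) G) =>
    leftField_surjective x (D (leftField w) x (leftField v x))
  have hinj (x : G) {v w : GroupLieAlgebra 𝓘(ℂ, E) G} (h : leftField v x = leftField w x) :
      v = w := hform.ext_right fun z => by
    have := inner_leftField g x z v
    rw [h, inner_leftField] at this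
    exact this.symm
  have hsub (x : G) (v w : GroupLieAlgebra 𝓘(ℂ, E) G) :
      leftField (v - w) x = leftField v x - leftField w x := by
    rw [eq_sub_iff_add_eq, ← leftField_add, sub_add_cancel]
  have hmdiff (v : GroupLieAlgebra 𝓘(ℂ, E) G) (x : G) :=
    (isSmooth_leftField v).mdifferentiable (by simp) x
  have htorsion (x : G) (v w : GroupLieAlgebra 𝓘(ℂ, E) G) :
      D.torsion x (leftField v x) (leftField w x)
        = leftField (Γ x v w - Γ x w v - ⁅v, w⁆) x := by
    have : IsManifold (realModel E) 2 G := IsManifold.of_le (n := ω) le_top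
    rw [hsub, hsub, hΓ, hΓ, ← mlieBracket_leftField]
    exact D.torsion_apply (hmdiff v x) (hmdiff w x)
  have hmetric (x : G) (u v w : GroupLieAlgebra 𝓘(ℂ, E) G) :
      innerOne g (Γ x u v) w + innerOne g v (Γ x u w) = 0 := by
    -- The product of two left-invariant fields is a constant function, so its derivative vanishes.
    have h := hD.metric _ _ (isSmooth_leftField v) (isSmooth_leftField w) x (leftField u x)
    rw [← hΓ, ← hΓ, inner_leftField, inner_leftField] at h
    simp only [inner_leftField] at h
    refine h.symm.trans ?_
    simp [mvfderiv]
  have hcomplex (x : G) (u v : GroupLieAlgebra 𝓘(ℂ, E) G) :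
      Γ x u (Complex.I • v) = Complex.I • Γ x u v := by
    refine hinj x ?_
    have h := hD.complex _ (isSmooth_leftField v) x (leftField u x)
    rw [← hΓ, ← leftField_I_smul] at h
    rw [← h, hΓ]
    congr 2
    ext y
    exact leftField_I_smul v y
  have hskew (x : G) (u v w : GroupLieAlgebra 𝓘(ℂ, E) G) :
      innerOne g (Γ x u v - Γ x v u - ⁅u, v⁆) w = -innerOne g (Γ x u w - Γ x w u - ⁅u, w⁆) v := by
    have h := hD.skew x (leftField u x) (leftField v x) (leftField w x)
    rwa [htorsion, htorsion, inner_leftField, inner_leftField] at h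
  have hconst (x : G) (u v : GroupLieAlgebra 𝓘(ℂ, E) G) : Γ x u v = Γ 1 u v := by
    refine hform.ext_right fun w => ?_
    rw [hform.symm, bismut_formula hform (hmetric x) (hcomplex x) (hskew x), hform.symm w,
      bismut_formula hform (hmetric 1) (hcomplex 1) (hskew 1)]
  refine hasDerivationAdjoints_of_bismut hform (hmetric 1) (hcomplex 1) (fun _ _ => rfl)
    (hskew 1) fun v x y => hinj 1 ?_
  -- As the coefficients are constant, the torsion of two left-invariant fields is itself
  -- left-invariant, and its covariant derivative is again given by `Γ`.
  have h := hpar _ _ (isSmooth_leftField x) (isSmooth_leftField y) 1 (leftField v 1)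
  rw [← hΓ, ← hΓ, htorsion, htorsion] at h
  rw [leftField_add, ← h, hΓ]
  congr 2
  ext z
  rw [htorsion, hconst z x y, hconst z y x]

end BTP

/-! ### Related vector fields and Lie group homomorphisms -/

section Related

open VectorField

variable {𝕜 : Type*} [NontriviallyNormedField 𝕜] {E F : Type*} [NormedAddCommGroup E]
  [NormedSpace 𝕜 E] [CompleteSpace E] [NormedAddCommGroup F] [NormedSpace 𝕜 F] [CompleteSpace F]
  {M N : Type*} [TopologicalSpace M] [ChartedSpace E M] [TopologicalSpace N] [ChartedSpace F N]
  [IsManifold 𝓘(𝕜, E) ω M] [IsManifold 𝓘(𝕜, F) ω N]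

omit [CompleteSpace E] [CompleteSpace F] in
/-- Reading `f`-related vector fields in charts. -/
theorem fderiv_writtenInExtChartAt_chartField {f : M → N}
    (hf : MDifferentiable 𝓘(𝕜, E) 𝓘(𝕜, F) f)
    {V : (x : M) → TangentSpace 𝓘(𝕜, E) x} {V' : (x : N) → TangentSpace 𝓘(𝕜, F) x}
    (hV : ∀ x, mfderiv 𝓘(𝕜, E) 𝓘(𝕜, F) f x (V x) = V' (f x)) (x₀ : M) :
    ∀ᶠ q in nhds (extChartAt 𝓘(𝕜, E) x₀ x₀),
      fderiv 𝕜 (writtenInExtChartAt 𝓘(𝕜, E) 𝓘(𝕜, F) x₀ f) q (chartField 𝕜 V x₀ q)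
        = chartField 𝕜 V' (f x₀) (writtenInExtChartAt 𝓘(𝕜, E) 𝓘(𝕜, F) x₀ f q) := by
  have : IsManifold 𝓘(𝕜, E) 1 M := IsManifold.of_le (n := ω) le_top
  have : IsManifold 𝓘(𝕜, F) 1 N := IsManifold.of_le (n := ω) le_top
  set φ := extChartAt 𝓘(𝕜, E) x₀ with hφ
  set ψ := extChartAt 𝓘(𝕜, F) (f x₀) with hψ
  have hcont : ContinuousAt (f ∘ φ.symm) (φ x₀) := by
    refine ContinuousAt.comp ?_ (continuousAt_extChartAt_symm x₀)
    rw [extChartAt_to_inv]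
    exact (hf x₀).continuousAt
  have hsource : ∀ᶠ q in nhds (φ x₀), f (φ.symm q) ∈ ψ.source := by
    refine hcont.eventually_mem ?_
    rw [Function.comp_apply, extChartAt_to_inv]
    exact extChartAt_source_mem_nhds (f x₀)
  filter_upwards [extChartAt_target_mem_nhds (I := 𝓘(𝕜, E)) x₀, hsource] with q hq hfq
  set y := φ.symm q with hy
  have hys : y ∈ φ.source := φ.map_target hq
  have hqy : φ y = q := φ.right_inv hq
  have hback : ψ.symm (writtenInExtChartAt 𝓘(𝕜, E) 𝓘(𝕜, F) x₀ f q) = f y := ψ.left_inv hfq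
  have hφy : MDifferentiableAt 𝓘(𝕜, E) 𝓘(𝕜, E) φ y :=
    mdifferentiableAt_extChartAt (by rwa [hφ, extChartAt_source] at hys)
  have hψy : MDifferentiableAt 𝓘(𝕜, F) 𝓘(𝕜, F) ψ (f y) :=
    mdifferentiableAt_extChartAt (by rwa [hψ, extChartAt_source] at hfq)
  have hφsymm : MDifferentiableAt 𝓘(𝕜, E) 𝓘(𝕜, E) φ.symm q := by
    have := mdifferentiableWithinAt_extChartAt_symm (I := 𝓘(𝕜, E)) hq
    rwa [modelWithCornersSelf_coe, Set.range_id, mdifferentiableWithinAt_univ] at this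
  have hw : MDifferentiableAt 𝓘(𝕜, E) 𝓘(𝕜, F) (writtenInExtChartAt 𝓘(𝕜, E) 𝓘(𝕜, F) x₀ f) q :=
    hψy.comp q ((hf y).comp q hφsymm)
  have heq : writtenInExtChartAt 𝓘(𝕜, E) 𝓘(𝕜, F) x₀ f ∘ φ =ᶠ[nhds y] ψ ∘ f := by
    filter_upwards [(isOpen_extChartAt_source x₀).mem_nhds hys] with z hz
    simp only [Function.comp_apply, writtenInExtChartAt]
    rw [φ.left_inv hz]
  have h₁ := mfderiv_comp_apply_of_eq y hw hφy hqy (V y)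
  have h₂ := mfderiv_comp_apply y hψy (hf y) (V y)
  rw [heq.mfderiv_eq] at h₁
  rw [mfderiv_eq_fderiv] at h₁
  refine h₁.symm.trans (h₂.trans ?_)
  rw [hV, chartField]
  have (z : N) (hz : z = f y) :
      (mfderiv 𝓘(𝕜, F) 𝓘(𝕜, F) ψ z (V' z) : F) = mfderiv 𝓘(𝕜, F) 𝓘(𝕜, F) ψ (f y) (V' (f y)) := by
    rw [hz]
  exact (this _ hback).symm

/-- The Lie bracket is compatible with `f`-related vector fields. -/
theorem mfderiv_apply_mlieBracket {f : M → N} (hf : ContMDiff 𝓘(𝕜, E) 𝓘(𝕜, F) ω f)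
    {V W : (x : M) → TangentSpace 𝓘(𝕜, E) x} {V' W' : (x : N) → TangentSpace 𝓘(𝕜, F) x}
    (hV : ∀ x, mfderiv 𝓘(𝕜, E) 𝓘(𝕜, F) f x (V x) = V' (f x))
    (hW : ∀ x, mfderiv 𝓘(𝕜, E) 𝓘(𝕜, F) f x (W x) = W' (f x)) {x₀ : M}
    (hVd : MDifferentiableAt 𝓘(𝕜, E) 𝓘(𝕜, E).tangent
      (fun x => (⟨x, V x⟩ : TangentBundle 𝓘(𝕜, E) M)) x₀)
    (hWd : MDifferentiableAt 𝓘(𝕜, E) 𝓘(𝕜, E).tangent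
      (fun x => (⟨x, W x⟩ : TangentBundle 𝓘(𝕜, E) M)) x₀)
    (hVd' : MDifferentiableAt 𝓘(𝕜, F) 𝓘(𝕜, F).tangent
      (fun x => (⟨x, V' x⟩ : TangentBundle 𝓘(𝕜, F) N)) (f x₀))
    (hWd' : MDifferentiableAt 𝓘(𝕜, F) 𝓘(𝕜, F).tangent
      (fun x => (⟨x, W' x⟩ : TangentBundle 𝓘(𝕜, F) N)) (f x₀)) :
    mfderiv 𝓘(𝕜, E) 𝓘(𝕜, F) f x₀ (mlieBracket 𝓘(𝕜, E) V W x₀)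
      = mlieBracket 𝓘(𝕜, F) V' W' (f x₀) := by
  have : IsManifold 𝓘(𝕜, E) 2 M := IsManifold.of_le (n := ω) le_top
  have : IsManifold 𝓘(𝕜, F) 2 N := IsManifold.of_le (n := ω) le_top
  have hmd : MDifferentiable 𝓘(𝕜, E) 𝓘(𝕜, F) f := hf.mdifferentiable (by simp)
  set φ := extChartAt 𝓘(𝕜, E) x₀ with hφ
  set ψ := extChartAt 𝓘(𝕜, F) (f x₀) with hψ
  let w := writtenInExtChartAt 𝓘(𝕜, E) 𝓘(𝕜, F) x₀ f
  have hw : ContDiffAt 𝕜 ω w (φ x₀) := by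
    have := (contMDiffAt_iff.1 (hf x₀)).2
    rwa [modelWithCornersSelf_coe, Set.range_id, contDiffWithinAt_univ] at this
  have hwx : w (φ x₀) = ψ (f x₀) := by
    change ψ (f (φ.symm (φ x₀))) = _
    rw [extChartAt_to_inv]
  -- By symmetry of second derivatives, Dw[V, W] = D(Dw W)V - D(Dw V)W; relatedness replaces Dw V by
  -- V' ∘ w, and likewise for W.
  have hbr := fderiv_apply_lieBracket hw le_top (differentiableAt_chartField hWd)
    (differentiableAt_chartField hVd)
  have key {V : (x : M) → TangentSpace 𝓘(𝕜, E) x} {V' : (x : N) → TangentSpace 𝓘(𝕜, F) x}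
      (hV : ∀ x, mfderiv 𝓘(𝕜, E) 𝓘(𝕜, F) f x (V x) = V' (f x))
      (hVd' : MDifferentiableAt 𝓘(𝕜, F) 𝓘(𝕜, F).tangent
        (fun x => (⟨x, V' x⟩ : TangentBundle 𝓘(𝕜, F) N)) (f x₀)) (u : E) :
      fderiv 𝕜 (fun q => fderiv 𝕜 w q (chartField 𝕜 V x₀ q)) (φ x₀) u
        = fderiv 𝕜 (chartField 𝕜 V' (f x₀)) (ψ (f x₀)) (fderiv 𝕜 w (φ x₀) u) := by
    have h : (fun q => fderiv 𝕜 w q (chartField 𝕜 V x₀ q)) =ᶠ[nhds (φ x₀)]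
        chartField 𝕜 V' (f x₀) ∘ w := fderiv_writtenInExtChartAt_chartField hmd hV x₀
    rw [h.fderiv_eq, fderiv_comp, hwx]
    · rfl
    · rw [hwx]
      exact differentiableAt_chartField hVd'
    · exact hw.differentiableAt (by simp)
  have hat {V : (x : M) → TangentSpace 𝓘(𝕜, E) x} {V' : (x : N) → TangentSpace 𝓘(𝕜, F) x}
      (hV : ∀ x, mfderiv 𝓘(𝕜, E) 𝓘(𝕜, F) f x (V x) = V' (f x)) :
      fderiv 𝕜 w (φ x₀) (chartField 𝕜 V x₀ (φ x₀)) = chartField 𝕜 V' (f x₀) (ψ (f x₀)) := by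
    rw [← hwx]
    exact (fderiv_writtenInExtChartAt_chartField hmd hV x₀).self_of_nhds
  rw [key hV hVd', key hW hWd', hat hV, hat hW] at hbr
  rw [mlieBracket_eq_lieBracket_chartField, mlieBracket_eq_lieBracket_chartField]
  have hfd (A : E →L[𝕜] F) (hA : HasFDerivWithinAt w A (Set.range 𝓘(𝕜, E)) (φ x₀)) :
      fderiv 𝕜 w (φ x₀) = A := by
    rw [modelWithCornersSelf_coe, Set.range_id, hasFDerivWithinAt_univ] at hA
    exact hA.fderiv
  exact (congrArg (fun A : E →L[𝕜] F => A _) (hfd _ (hmd x₀).hasMFDerivAt.2)).symm.trans hbr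

end Related

section Homomorphism

variable {𝕜 : Type*} [NontriviallyNormedField 𝕜] {E F : Type*} [NormedAddCommGroup E]
  [NormedSpace 𝕜 E] [NormedAddCommGroup F] [NormedSpace 𝕜 F]
  {G H : Type*} [TopologicalSpace G] [ChartedSpace E G] [Group G] [LieGroup 𝓘(𝕜, E) ω G]
  [TopologicalSpace H] [ChartedSpace F H] [Group H] [LieGroup 𝓘(𝕜, F) ω H]

/-- A homomorphism of Lie groups maps left-invariant vector fields to left-invariant ones. -/
theorem mfderiv_mulInvariantVectorField {f : G → H} (hf : ContMDiff 𝓘(𝕜, E) 𝓘(𝕜, F) ω f)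
    (hmul : ∀ a b, f (a * b) = f a * f b) (v : GroupLieAlgebra 𝓘(𝕜, E) G)
    (v' : GroupLieAlgebra 𝓘(𝕜, F) H)
    (hv : (mfderiv 𝓘(𝕜, E) 𝓘(𝕜, F) f 1 v : F) = v') (x : G) :
    mfderiv 𝓘(𝕜, E) 𝓘(𝕜, F) f x (mulInvariantVectorField v x) = mulInvariantVectorField v' (f x) := by
  have hmd : MDifferentiable 𝓘(𝕜, E) 𝓘(𝕜, F) f := hf.mdifferentiable (by simp)
  have hG (a y : G) : MDifferentiableAt 𝓘(𝕜, E) 𝓘(𝕜, E) (fun y => a * y) y :=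
    (contMDiff_mul_left (n := ω)).mdifferentiable (by simp) y
  have hH (a y : H) : MDifferentiableAt 𝓘(𝕜, F) 𝓘(𝕜, F) (fun y => a * y) y :=
    (contMDiff_mul_left (n := ω)).mdifferentiable (by simp) y
  have h1 : f 1 = 1 := by simpa using hmul 1 1
  have hcomp : f ∘ (fun y => x * y) = (fun y => f x * y) ∘ f := by
    ext y
    exact hmul x y
  have h₁ := mfderiv_comp_apply_of_eq 1 (hmd x) (hG x 1) (mul_one x) v
  have h₂ := mfderiv_comp_apply_of_eq 1 (hH (f x) 1) (hmd 1) h1 v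
  rw [hcomp] at h₁
  refine h₁.symm.trans (h₂.trans ?_)
  exact congrArg (fun u : F => (mfderiv 𝓘(𝕜, F) 𝓘(𝕜, F) (fun y => f x * y) 1 : F →L[𝕜] F) u) hv

end Homomorphism

/-! ### Left-invariant metrics from forms at the identity -/

section MetricOfForm

variable {E : Type*} [NormedAddCommGroup E] [NormedSpace ℂ E]
  {G : Type*} [TopologicalSpace G] [ChartedSpace E G] [Group G] [LieGroup 𝓘(ℂ, E) ω G]

variable (E) in
/-- The derivative at `x` of the left translation by `x⁻¹`. -/
noncomputable def maurerCartan (x : G) : E →L[ℝ] E :=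
  let A := mfderiv (realModel E) (realModel E) (fun y => x⁻¹ * y) x
  A

theorem mfderiv_mul_leftField (a x : G) (v : GroupLieAlgebra 𝓘(ℂ, E) G) :
    mfderiv (realModel E) (realModel E) (fun y => a * y) x (leftField v x)
      = leftField v (a * x) := by
  have hmul (a y : G) := mdifferentiableAt_restrictScalars (mdifferentiableAt_mul_left (E := E) a y)
  have h : mfderiv (realModel E) (realModel E) ((fun y => a * y) ∘ fun y => x * y) 1
      (toReal 1 v) = _ :=
    mfderiv_comp_apply_of_eq 1 (hmul a x) (hmul x 1) (mul_one x) _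
  have hcomp : (fun y => a * y) ∘ (fun y => x * y) = fun y => (a * x) * y := by
    ext y
    exact (mul_assoc a x y).symm
  rw [hcomp] at h
  rw [leftField_eq_mfderiv, leftField_eq_mfderiv]
  exact h.symm

theorem maurerCartan_leftField (x : G) (v : GroupLieAlgebra 𝓘(ℂ, E) G) :
    maurerCartan E x (leftField v x) = (v : E) := by
  have hmul (a y : G) := mdifferentiableAt_restrictScalars (mdifferentiableAt_mul_left (E := E) a y)
  have h : mfderiv (realModel E) (realModel E) ((fun y => x⁻¹ * y) ∘ fun y => x * y) 1
      (toReal 1 v) = _ :=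
    mfderiv_comp_apply_of_eq 1 (hmul x⁻¹ x) (hmul x 1) (mul_one x) _
  have hid : (fun y => x⁻¹ * y) ∘ (fun y => x * y) = id := by
    ext y
    simp
  rw [hid, mfderiv_id] at h
  rw [leftField_eq_mfderiv]
  exact h.symm

/-- The left-invariant metric with given value at the identity. -/
noncomputable def metricOfForm (B : E →L[ℝ] E →L[ℝ] ℝ) (hB : IsHermitianForm fun x y => B x y) :
    LeftInvariantHermitianMetric E G where
  inner x := (B.bilinearComp (maurerCartan E x) (maurerCartan E x) : E →L[ℝ] E →L[ℝ] ℝ)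
  symm x u v := hB.symm _ _
  pos x u hu := by
    obtain ⟨v, rfl⟩ := leftField_surjective x u
    refine hB.pos _ ((maurerCartan_leftField x v).trans_ne ?_)
    rintro rfl
    exact hu (map_zero (mfderiv 𝓘(ℂ, E) 𝓘(ℂ, E) (fun y => x * y) 1))
  hermitian x u v := by
    obtain ⟨u, rfl⟩ := leftField_surjective x u
    obtain ⟨v, rfl⟩ := leftField_surjective x v
    rw [← leftField_I_smul, ← leftField_I_smul]
    change B (maurerCartan E x (leftField _ x)) (maurerCartan E x (leftField _ x))
      = B (maurerCartan E x (leftField _ x)) (maurerCartan E x (leftField _ x))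
    rw [maurerCartan_leftField, maurerCartan_leftField, maurerCartan_leftField,
      maurerCartan_leftField]
    exact hB.I_smul u v
  left_invariant a x u v := by
    obtain ⟨u, rfl⟩ := leftField_surjective x u
    obtain ⟨v, rfl⟩ := leftField_surjective x v
    rw [mfderiv_mul_leftField, mfderiv_mul_leftField]
    change B (maurerCartan E (a * x) (leftField _ _)) (maurerCartan E (a * x) (leftField _ _))
      = B (maurerCartan E x (leftField _ x)) (maurerCartan E x (leftField _ x))
    rw [maurerCartan_leftField, maurerCartan_leftField, maurerCartan_leftField,
      maurerCartan_leftField]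

theorem innerOne_metricOfForm (B : E →L[ℝ] E →L[ℝ] ℝ) (hB : IsHermitianForm fun x y => B x y)
    (X Y : GroupLieAlgebra 𝓘(ℂ, E) G) :
    innerOne (metricOfForm (G := G) B hB) X Y = B X Y := by
  rw [innerOne, ← leftField_one, ← leftField_one]
  change B (maurerCartan E 1 (leftField X 1)) (maurerCartan E 1 (leftField Y 1)) = _
  rw [maurerCartan_leftField, maurerCartan_leftField]

end MetricOfForm

section LieHomomorphism

variable {E F : Type*} [NormedAddCommGroup E] [NormedSpace ℂ E] [NormedAddCommGroup F]
  [NormedSpace ℂ F] [CompleteSpace E] [CompleteSpace F]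
  {G H : Type*} [TopologicalSpace G] [ChartedSpace E G] [Group G] [LieGroup 𝓘(ℂ, E) ω G]
  [TopologicalSpace H] [ChartedSpace F H] [Group H] [LieGroup 𝓘(ℂ, F) ω H]

/-- A left-invariant field is `f`-related to the left-invariant field of its image, and brackets
respect relatedness. The derivative is read in the model space because `f 1` and `1` index different
tangent spaces. -/
theorem lie_of_mfderiv_eq {f : G → H} (hf : ContMDiff 𝓘(ℂ, E) 𝓘(ℂ, F) ω f)
    (hmul : ∀ a b, f (a * b) = f a * f b)
    (φ : GroupLieAlgebra 𝓘(ℂ, E) G → GroupLieAlgebra 𝓘(ℂ, F) H)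
    (hφ : ∀ v, (mfderiv 𝓘(ℂ, E) 𝓘(ℂ, F) f 1 v : F) = φ v) (v w : GroupLieAlgebra 𝓘(ℂ, E) G) :
    φ ⁅v, w⁆ = ⁅φ v, φ w⁆ := by
  have h := mfderiv_apply_mlieBracket hf (mfderiv_mulInvariantVectorField hf hmul v _ (hφ v))
    (mfderiv_mulInvariantVectorField hf hmul w _ (hφ w)) (x₀ := 1)
    (mdifferentiableAt_mulInvariantVectorField v) (mdifferentiableAt_mulInvariantVectorField w)
    (mdifferentiableAt_mulInvariantVectorField _) (mdifferentiableAt_mulInvariantVectorField _)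
  have h1 : f 1 = 1 := by simpa using hmul 1 1
  refine (hφ _).symm.trans (h.trans ?_)
  rw [GroupLieAlgebra.bracket_def, h1]

omit [CompleteSpace E] [CompleteSpace F] in
theorem mfderiv_leftField {f : G → H} (hf : ContMDiff 𝓘(ℂ, E) 𝓘(ℂ, F) ω f)
    (hmul : ∀ a b, f (a * b) = f a * f b) (v : GroupLieAlgebra 𝓘(ℂ, E) G)
    (v' : GroupLieAlgebra 𝓘(ℂ, F) H)
    (hv : (mfderiv 𝓘(ℂ, E) 𝓘(ℂ, F) f 1 v : F) = v') (x : G) :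
    mfderiv (realModel E) (realModel F) f x (leftField v x) = leftField v' (f x) := by
  refine (mfderiv_restrictScalars (hf.mdifferentiable (by simp) x) _).trans ?_
  rw [mfderiv_mulInvariantVectorField hf hmul v v' hv]
  rfl

end LieHomomorphism

/-! ### The Lie algebra of the product group -/

section ProductAlgebra

variable {r k : ℕ} {E : Fin r → Type*} [∀ i, NormedAddCommGroup (E i)] [∀ i, NormedSpace ℂ (E i)]
  {G : Fin r → Type*} [∀ i, TopologicalSpace (G i)] [∀ i, ChartedSpace (E i) (G i)]
  [∀ i, Group (G i)]

variable (k E G) in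
/-- The Lie algebra of `ℂ^k × G_1 × ⋯ × G_r`. -/
abbrev ProductLieAlgebra : Type _ := GroupLieAlgebra 𝓘(ℂ, ProductModel k E) (ProductGroup k G)

omit [∀ i, Group (G i)] in
theorem hasMFDerivAt_toVector (p : ProductGroup k G) :
    HasMFDerivAt 𝓘(ℂ, ProductModel k E) 𝓘(ℂ, EuclideanSpace ℂ (Fin k)) (toVector k) p
      (ContinuousLinearMap.fst ℂ (EuclideanSpace ℂ (Fin k)) ((i : Fin r) → E i) :
        ProductModel k E →L[ℂ] EuclideanSpace ℂ (Fin k)) :=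
  ⟨(contMDiff_toVector k E G).continuous.continuousAt, hasFDerivWithinAt_fst⟩

omit [∀ i, Group (G i)] in
theorem hasMFDerivAt_toFactor (i : Fin r) (p : ProductGroup k G) :
    HasMFDerivAt 𝓘(ℂ, ProductModel k E) 𝓘(ℂ, E i) (toFactor k i) p
      ((ContinuousLinearMap.proj (R := ℂ) (φ := E) i).comp
        (ContinuousLinearMap.snd ℂ (EuclideanSpace ℂ (Fin k)) ((i : Fin r) → E i)) :
        ProductModel k E →L[ℂ] E i) := by
  refine ⟨(contMDiff_toFactor k E G i).continuous.continuousAt, ?_⟩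
  have key : ∀ q ∈ (extChartAt 𝓘(ℂ, ProductModel k E) p).target,
      writtenInExtChartAt 𝓘(ℂ, ProductModel k E) 𝓘(ℂ, E i) p (toFactor k i) q = q.2 i := by
    intro q hq
    have hq' : q.2 i ∈ (chartAt (E i) (p.2 i)).target := by
      rw [extChartAt_target] at hq
      exact hq.1.2 i trivial
    exact (chartAt (E i) (p.2 i)).right_inv hq'
  refine (ContinuousLinearMap.hasFDerivWithinAt _).congr_of_eventuallyEq ?_ ?_
  · filter_upwards [extChartAt_target_mem_nhdsWithin (I := 𝓘(ℂ, ProductModel k E)) p] with q hq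
    exact key q hq
  · exact key _ (mem_extChartAt_target p)

/-- The projection of the Lie algebra to the Euclidean factor. -/
noncomputable def vectorProj : ProductLieAlgebra k E G →ₗ[ℂ]
    GroupLieAlgebra 𝓘(ℂ, EuclideanSpace ℂ (Fin k)) (VectorGroup k) :=
  LinearMap.fst ℂ (EuclideanSpace ℂ (Fin k)) ((i : Fin r) → E i)

/-- The projection of the Lie algebra to a factor. -/
noncomputable def factorProj (i : Fin r) : ProductLieAlgebra k E G →ₗ[ℂ] GroupLieAlgebra 𝓘(ℂ, E i) (G i) :=
  LinearMap.proj (R := ℂ) (φ := E) i ∘ₗ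
    LinearMap.snd ℂ (EuclideanSpace ℂ (Fin k)) ((i : Fin r) → E i)

/-- The inclusion of the Lie algebra of the Euclidean factor. -/
noncomputable def vectorIncl : GroupLieAlgebra 𝓘(ℂ, EuclideanSpace ℂ (Fin k)) (VectorGroup k) →ₗ[ℂ]
    ProductLieAlgebra k E G :=
  LinearMap.inl ℂ (EuclideanSpace ℂ (Fin k)) ((i : Fin r) → E i)

/-- The inclusion of the Lie algebra of a factor. -/
noncomputable def factorIncl (i : Fin r) : GroupLieAlgebra 𝓘(ℂ, E i) (G i) →ₗ[ℂ] ProductLieAlgebra k E G :=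
  LinearMap.inr ℂ (EuclideanSpace ℂ (Fin k)) ((i : Fin r) → E i) ∘ₗ LinearMap.single ℂ E i

theorem product_ext {X Y : ProductLieAlgebra k E G} (h₀ : vectorProj X = vectorProj Y)
    (h : ∀ i, factorProj i X = factorProj i Y) : X = Y :=
  Prod.ext h₀ (funext h)

@[simp] theorem vectorProj_vectorIncl (a) :
    vectorProj (vectorIncl a : ProductLieAlgebra k E G) = a := rfl

@[simp] theorem factorProj_vectorIncl (i : Fin r) (a) :
    factorProj i (vectorIncl a : ProductLieAlgebra k E G) = 0 := rfl

@[simp] theorem vectorProj_factorIncl (i : Fin r) (a) :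
    vectorProj (factorIncl i a : ProductLieAlgebra k E G) = 0 := rfl

@[simp] theorem factorProj_factorIncl (i : Fin r) (a) :
    factorProj i (factorIncl i a : ProductLieAlgebra k E G) = a :=
  Pi.single_eq_same (M := E) i a

theorem factorProj_factorIncl_of_ne {i j : Fin r} (h : j ≠ i) (a) :
    factorProj j (factorIncl i a : ProductLieAlgebra k E G) = 0 :=
  Pi.single_eq_of_ne (M := E) h a

theorem eq_sum_incl (X : ProductLieAlgebra k E G) :
    X = vectorIncl (vectorProj X) + ∑ i, factorIncl i (factorProj i X) := by
  refine product_ext ?_ fun i => ?_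
  · simp
  · rw [map_add, map_sum, Finset.sum_eq_single i]
    · simp
    · intro j _ hj
      exact factorProj_factorIncl_of_ne hj.symm _
    · simp

variable [∀ i, LieGroup 𝓘(ℂ, E i) ω (G i)]

variable [∀ i, FiniteDimensional ℂ (E i)]

theorem vectorProj_lie (X Y : ProductLieAlgebra k E G) :
    vectorProj ⁅X, Y⁆ = ⁅vectorProj X, vectorProj Y⁆ := by
  have (i : Fin r) : CompleteSpace (E i) := FiniteDimensional.complete ℂ (E i)
  refine lie_of_mfderiv_eq (contMDiff_toVector k E G) (fun _ _ => rfl) _ (fun v => ?_) X Y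
  rw [(hasMFDerivAt_toVector 1).mfderiv]
  rfl

theorem factorProj_lie (i : Fin r) (X Y : ProductLieAlgebra k E G) :
    factorProj i ⁅X, Y⁆ = ⁅factorProj i X, factorProj i Y⁆ := by
  have (i : Fin r) : CompleteSpace (E i) := FiniteDimensional.complete ℂ (E i)
  refine lie_of_mfderiv_eq (contMDiff_toFactor k E G i) (fun _ _ => rfl) _ (fun v => ?_) X Y
  rw [(hasMFDerivAt_toFactor i 1).mfderiv]
  rfl

theorem lie_factorIncl (i : Fin r) (X : ProductLieAlgebra k E G)
    (a : GroupLieAlgebra 𝓘(ℂ, E i) (G i)) :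
    ⁅X, (factorIncl i a : ProductLieAlgebra k E G)⁆ = factorIncl i ⁅factorProj i X, a⁆ := by
  refine product_ext ?_ fun j => ?_
  · simp [vectorProj_lie]
  · rw [factorProj_lie]
    by_cases h : j = i
    · subst h
      simp
    · simp [factorProj_factorIncl_of_ne h]

omit [∀ i, FiniteDimensional ℂ (E i)] in
-- The projections are homomorphisms and carry left-invariant fields to left-invariant fields. On
-- these every metric involved is constant, so the identity element decides.
theorem isProductMetric_iff
    {g : LeftInvariantHermitianMetric (ProductModel k E) (ProductGroup k G)}
    {g₀ : LeftInvariantHermitianMetric (EuclideanSpace ℂ (Fin k)) (VectorGroup k)}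
    {gs : (i : Fin r) → LeftInvariantHermitianMetric (E i) (G i)} :
    IsProductMetric g g₀ gs ↔ ∀ X Y, innerOne g X Y
      = innerOne g₀ (vectorProj X) (vectorProj Y)
        + ∑ i, innerOne (gs i) (factorProj i X) (factorProj i Y) := by
  have hvec (p : ProductGroup k G) (X : ProductLieAlgebra k E G) :
      mfderiv (realModel (ProductModel k E)) (realModel (EuclideanSpace ℂ (Fin k)))
        (toVector k) p (leftField X p) = leftField (vectorProj X) (toVector k p) := by
    refine mfderiv_leftField (contMDiff_toVector k E G) (fun _ _ => rfl) _ _ ?_ p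
    rw [(hasMFDerivAt_toVector 1).mfderiv]
    rfl
  have hfac (i : Fin r) (p : ProductGroup k G) (X : ProductLieAlgebra k E G) :
      mfderiv (realModel (ProductModel k E)) (realModel (E i))
        (toFactor k i) p (leftField X p) = leftField (factorProj i X) (toFactor k i p) := by
    refine mfderiv_leftField (contMDiff_toFactor k E G i) (fun _ _ => rfl) _ _ ?_ p
    rw [(hasMFDerivAt_toFactor i 1).mfderiv]
    rfl
  constructor
  · intro h X Y
    have := h 1 (leftField X 1) (leftField Y 1)
    rw [hvec, hvec] at this
    simp only [hfac, inner_leftField] at this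
    exact this
  · intro h p u v
    obtain ⟨X, rfl⟩ := leftField_surjective p u
    obtain ⟨Y, rfl⟩ := leftField_surjective p v
    rw [hvec, hvec]
    simp only [hfac, inner_leftField]
    exact h X Y

end ProductAlgebra

theorem IsHermitianForm.sum_left {V ι : Type*} [AddCommGroup V] [Module ℂ V] {g : V → V → ℝ}
    (hg : IsHermitianForm g) (s : Finset ι) (f : ι → V) (y : V) :
    g (∑ i ∈ s, f i) y = ∑ i ∈ s, g (f i) y := by
  classical
  induction s using Finset.induction_on with
  | empty => simp [hg.zero_left]
  | insert a s ha ih => rw [Finset.sum_insert ha, Finset.sum_insert ha, hg.add_left, ih]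

theorem IsHermitianForm.comp_injective {V W : Type*} [AddCommGroup V] [Module ℂ V]
    [AddCommGroup W] [Module ℂ W] {g : V → V → ℝ} (hg : IsHermitianForm g) (φ : W →ₗ[ℂ] V)
    (hφ : Function.Injective φ) : IsHermitianForm fun x y => g (φ x) (φ y) where
  add_left x y z := by rw [map_add, hg.add_left]
  smul_left c x y := by rw [map_smul, hg.smul_left]
  symm x y := hg.symm _ _
  pos x hx := hg.pos _ ((map_ne_zero_iff φ hφ).2 hx)
  I_smul x y := by rw [map_smul, map_smul, hg.I_smul]

/-- The derived algebra is an ideal, and it is nonzero since the algebra is not abelian. -/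
theorem mem_span_lie_of_isSimple {L : Type*} [LieRing L] [LieAlgebra ℂ L]
    [LieAlgebra.IsSimple ℂ L] (x : L) : x ∈ Submodule.span ℂ {w : L | ∃ a c : L, ⁅a, c⁆ = w} := by
  have h : ⁅(⊤ : LieIdeal ℂ L), (⊤ : LieIdeal ℂ L)⁆ = ⊤ := by
    refine (LieAlgebra.IsSimple.eq_bot_or_eq_top _).resolve_left fun h => ?_
    refine LieAlgebra.IsSimple.non_abelian (R := ℂ) (L := L) ⟨fun a c => ?_⟩
    have := LieSubmodule.lie_mem_lie (I := (⊤ : LieIdeal ℂ L)) (N := (⊤ : LieIdeal ℂ L))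
      (LieSubmodule.mem_top a) (LieSubmodule.mem_top c)
    rwa [h, LieSubmodule.mem_bot] at this
  have hx : x ∈ LieSubmodule.toSubmodule ⁅(⊤ : LieIdeal ℂ L), (⊤ : LieIdeal ℂ L)⁆ := by
    rw [h]
    trivial
  rw [LieSubmodule.lieIdeal_oper_eq_linear_span'] at hx
  refine Submodule.span_mono ?_ hx
  rintro w ⟨a, -, c, -, rfl⟩
  exact ⟨a, c, rfl⟩

/-! ### Splitting of the metric -/

section Product

variable {r k : ℕ} {E : Fin r → Type*} [∀ i, NormedAddCommGroup (E i)] [∀ i, NormedSpace ℂ (E i)]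
  {G : Fin r → Type*} [∀ i, TopologicalSpace (G i)] [∀ i, ChartedSpace (E i) (G i)]
  [∀ i, Group (G i)] [∀ i, LieGroup 𝓘(ℂ, E i) ω (G i)] [∀ i, FiniteDimensional ℂ (E i)]
  {g : LeftInvariantHermitianMetric (ProductModel k E) (ProductGroup k G)}

/-- The factor is a perfect ideal with trivial centre, and an element with vanishing `i`-th
component centralizes it. -/
theorem innerOne_factorIncl_eq_zero (hD : HasDerivationAdjoints (innerOne g)) (i : Fin r)
    [LieAlgebra.IsSimple ℂ (GroupLieAlgebra 𝓘(ℂ, E i) (G i))]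
    (a : GroupLieAlgebra 𝓘(ℂ, E i) (G i)) {X : ProductLieAlgebra k E G}
    (hX : factorProj i X = 0) : innerOne g (factorIncl i a) X = 0 := by
  let s : GroupLieAlgebra 𝓘(ℂ, E i) (G i) →ₗ[ℂ] ProductLieAlgebra k E G := factorIncl i
  have hs (X : ProductLieAlgebra k E G) (a : GroupLieAlgebra 𝓘(ℂ, E i) (G i)) :
      ⁅X, s a⁆ = s ⁅factorProj i X, a⁆ := lie_factorIncl i X a
  have hps (a : GroupLieAlgebra 𝓘(ℂ, E i) (G i)) : factorProj i (s a) = a :=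
    factorProj_factorIncl i a
  refine hD.orthogonal_centralizer (isHermitianForm_innerOne g) (LinearMap.range s)
    ?_ ?_ ?_ ?_ ⟨a, rfl⟩
  · rintro x _ ⟨c, rfl⟩
    rw [hs]
    exact ⟨_, rfl⟩
  · rintro _ ⟨c, rfl⟩
    have := Submodule.mem_map_of_mem (f := s) (mem_span_lie_of_isSimple c)
    rw [Submodule.map_span] at this
    refine Submodule.span_mono ?_ this
    rintro _ ⟨_, ⟨u, v, rfl⟩, rfl⟩
    refine ⟨s u, ⟨u, rfl⟩, s v, ⟨v, rfl⟩, ?_⟩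
    rw [hs, hps]
  · rintro _ ⟨u, rfl⟩ hu
    have : u = 0 := eq_of_forall_lie_eq fun z => by
      have := congrArg (factorProj i) (hu (s z) ⟨z, rfl⟩)
      rw [hs, hps, hps, map_zero] at this
      rw [this, zero_lie]
    rw [this, map_zero]
  · rintro _ ⟨c, rfl⟩
    rw [hs, hX, zero_lie, map_zero]

variable [∀ i, LieAlgebra.IsSimple ℂ (GroupLieAlgebra 𝓘(ℂ, E i) (G i))]

theorem innerOne_eq_sum (hD : HasDerivationAdjoints (innerOne g)) (X Y : ProductLieAlgebra k E G) :
    innerOne g X Y = innerOne g (vectorIncl (vectorProj X)) (vectorIncl (vectorProj Y))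
      + ∑ i, innerOne g (factorIncl i (factorProj i X)) (factorIncl i (factorProj i Y)) := by
  have hg := isHermitianForm_innerOne g
  have hfac (i : Fin r) : innerOne g (factorIncl i (factorProj i X)) Y
      = innerOne g (factorIncl i (factorProj i X)) (factorIncl i (factorProj i Y)) := by
    rw [← sub_eq_zero, ← hg.sub_right]
    exact innerOne_factorIncl_eq_zero hD i _ (by simp)
  have hvec : innerOne g (vectorIncl (vectorProj X)) Y
      = innerOne g (vectorIncl (vectorProj X)) (vectorIncl (vectorProj Y)) := by
    conv_lhs => rw [eq_sum_incl Y]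
    rw [hg.add_right, hg.symm _ (∑ i, _), hg.sum_left, Finset.sum_eq_zero, add_zero]
    exact fun i _ => innerOne_factorIncl_eq_zero hD i _ (by simp)
  conv_lhs => rw [eq_sum_incl X]
  rw [hg.add_left, hg.sum_left, hvec, Finset.sum_congr rfl fun i _ => hfac i]

theorem exists_isProductMetric (hD : HasDerivationAdjoints (innerOne g)) :
    ∃ (g₀ : LeftInvariantHermitianMetric (EuclideanSpace ℂ (Fin k)) (VectorGroup k))
      (gs : (i : Fin r) → LeftInvariantHermitianMetric (E i) (G i)), IsProductMetric g g₀ gs := by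
  have hg := isHermitianForm_innerOne g
  let B : ProductModel k E →L[ℝ] ProductModel k E →L[ℝ] ℝ := g.inner 1
  -- Each factor metric is the restriction of the form at the identity to that summand, spread by
  -- left translation.
  let s₀ : EuclideanSpace ℂ (Fin k) →L[ℝ] ProductModel k E :=
    ContinuousLinearMap.inl ℝ (EuclideanSpace ℂ (Fin k)) ((i : Fin r) → E i)
  let s (i : Fin r) : E i →L[ℝ] ProductModel k E :=
    (ContinuousLinearMap.inr ℝ (EuclideanSpace ℂ (Fin k)) ((i : Fin r) → E i)).comp
      (ContinuousLinearMap.single ℝ E i)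
  have hB₀ : IsHermitianForm fun x y => B.bilinearComp s₀ s₀ x y :=
    hg.comp_injective (vectorIncl : _ →ₗ[ℂ] ProductLieAlgebra k E G)
      (Function.LeftInverse.injective vectorProj_vectorIncl)
  have hB (i : Fin r) : IsHermitianForm fun x y => B.bilinearComp (s i) (s i) x y :=
    hg.comp_injective (factorIncl i : _ →ₗ[ℂ] ProductLieAlgebra k E G)
      (Function.LeftInverse.injective (factorProj_factorIncl i))
  refine ⟨metricOfForm _ hB₀, fun i => metricOfForm _ (hB i), isProductMetric_iff.2 fun X Y => ?_⟩
  simp only [innerOne_metricOfForm]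
  exact innerOne_eq_sum hD X Y

omit [∀ i, LieAlgebra.IsSimple ℂ (GroupLieAlgebra 𝓘(ℂ, E i) (G i))] in
-- This makes the comparison available for factors not known to be BTP themselves. Inclusion and
-- projection are Lie homomorphisms, so the compression of a derivation to the factor is a
-- derivation; orthogonality of the splitting makes it the adjoint.
theorem hasDerivationAdjoints_factor (hD : HasDerivationAdjoints (innerOne g))
    {g₀ : LeftInvariantHermitianMetric (EuclideanSpace ℂ (Fin k)) (VectorGroup k)}
    {gs : (i : Fin r) → LeftInvariantHermitianMetric (E i) (G i)} (h : IsProductMetric g g₀ gs)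
    (i : Fin r) : HasDerivationAdjoints (innerOne (gs i)) := by
  rw [isProductMetric_iff] at h
  have hincl (X : ProductLieAlgebra k E G) (a : GroupLieAlgebra 𝓘(ℂ, E i) (G i)) :
      innerOne g (factorIncl i a) X = innerOne (gs i) a (factorProj i X) := by
    rw [h, Finset.sum_eq_single i]
    · simp [(isHermitianForm_innerOne g₀).zero_left]
    · intro j _ hj
      rw [factorProj_factorIncl_of_ne hj, (isHermitianForm_innerOne (gs j)).zero_left]
    · simp
  intro a
  obtain ⟨D, hDa⟩ := hD (factorIncl i a)
  refine ⟨⟨factorProj i ∘ₗ (D : ProductLieAlgebra k E G →ₗ[ℂ] ProductLieAlgebra k E G) ∘ₗ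
    factorIncl i, fun u v => ?_⟩, fun u v => ?_⟩
  · change factorProj i (D (factorIncl i ⁅u, v⁆))
      = ⁅u, factorProj i (D (factorIncl i v))⁆ - ⁅v, factorProj i (D (factorIncl i u))⁆
    have : (factorIncl i ⁅u, v⁆ : ProductLieAlgebra k E G) 
        = ⁅(factorIncl i u : ProductLieAlgebra k E G), factorIncl i v⁆ := by
      rw [lie_factorIncl, factorProj_factorIncl]
    rw [this, D.apply_lie_eq_sub, map_sub, factorProj_lie, factorProj_lie, factorProj_factorIncl,
      factorProj_factorIncl]
  · change _ = innerOne (gs i) u (factorProj i (D (factorIncl i v)))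
    rw [← hincl, ← hDa, lie_factorIncl, factorProj_factorIncl, hincl, factorProj_factorIncl]

end Product

section DifferByIsometry

variable {E : Type*} [NormedAddCommGroup E] [NormedSpace ℂ E] [FiniteDimensional ℂ E]
  {G : Type*} [TopologicalSpace G] [ChartedSpace E G] [Group G] [LieGroup 𝓘(ℂ, E) ω G]
  [LieAlgebra.IsSimple ℂ (GroupLieAlgebra 𝓘(ℂ, E) G)]

theorem differByMultipleOfBIsometry {g h : LeftInvariantHermitianMetric E G}
    (hg : HasDerivationAdjoints (innerOne g)) (hh : HasDerivationAdjoints (innerOne h)) :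
    DifferByMultipleOfBIsometry g h :=
  hg.exists_isometry (isHermitianForm_innerOne g) (isHermitianForm_innerOne h) hh

end DifferByIsometry

/-! ### Constant metrics on vector spaces -/

section ConstantMetric

open VectorField

variable {V : Type*} [NormedAddCommGroup V] [NormedSpace ℂ V]

theorem IsSmooth.contDiff {X : VField V V} (hX : IsSmooth X) : ContDiff ℝ ∞ (X : V → V) :=
  contMDiff_vectorSpace_iff_contDiff.1 hX

theorem fderiv_bilin_apply (B : V →L[ℝ] V →L[ℝ] ℝ) {X Y : V → V} {x : V}
    (hX : DifferentiableAt ℝ X x) (hY : DifferentiableAt ℝ Y x) (v : V) :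
    fderiv ℝ (fun y => B (X y) (Y y)) x v = B (X x) (fderiv ℝ Y x v) + B (fderiv ℝ X x v) (Y x) := by
  rw [B.fderiv_of_bilinear hX hY]
  rfl

theorem mvfderiv_bilin_apply (B : V →L[ℝ] V →L[ℝ] ℝ) {X Y : V → V} {x : V}
    (hX : DifferentiableAt ℝ X x) (hY : DifferentiableAt ℝ Y x) (v : V) :
    mvfderiv (realModel V) (fun y => B (X y) (Y y)) x v
      = B (X x) (fderiv ℝ Y x v) + B (fderiv ℝ X x v) (Y x) := by
  rw [← fderiv_bilin_apply B hX hY, ← mfderiv_eq_fderiv]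
  rfl

theorem mlieBracket_vectorSpace (X Y : VField V V) (x : V) :
    mlieBracket (realModel V) X Y x = lieBracket ℝ (X : V → V) (Y : V → V) x := by
  rw [← mlieBracketWithin_univ, mlieBracketWithin_eq_lieBracketWithin]
  exact congrFun lieBracketWithin_univ x

/-- A constant `2`-form is closed. -/
theorem exteriorDeriv_constant (Ω : V →L[ℝ] V →L[ℝ] ℝ) (hskew : ∀ u v, Ω u v = -Ω v u)
    (X Y Z : V → V) (x : V) :
    (Ω (Y x) (fderiv ℝ Z x (X x)) + Ω (fderiv ℝ Y x (X x)) (Z x))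
      - (Ω (X x) (fderiv ℝ Z x (Y x)) + Ω (fderiv ℝ X x (Y x)) (Z x))
      + (Ω (X x) (fderiv ℝ Y x (Z x)) + Ω (fderiv ℝ X x (Z x)) (Y x))
      - Ω (lieBracket ℝ X Y x) (Z x)
      + Ω (lieBracket ℝ X Z x) (Y x)
      - Ω (lieBracket ℝ Y Z x) (X x) = 0 := by
  simp only [lieBracket, map_sub, sub_apply]
  rw [hskew (Y x), hskew (X x), hskew (X x)]
  ring

/-- A metric with constant coefficients on a vector space is Kähler. -/
theorem isKahler_of_constant (g : BilinField V V) (B : V →L[ℝ] V →L[ℝ] ℝ)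
    (hB : IsHermitianForm fun x y => B x y) (hg : ∀ x, g x = B) : IsKahler g := by
  obtain rfl : g = fun _ => B := funext hg
  intro X Y Z hX hY hZ x
  let Ω : V →L[ℝ] V →L[ℝ] ℝ := B.comp (Complex.I • ContinuousLinearMap.id ℝ V)
  have hskew (u v : V) : Ω u v = -Ω v u := by
    change B (Complex.I • u) v = -B (Complex.I • v) u
    have : B (Complex.I • u) v = -B u (Complex.I • v) := hB.I_smul_left u v
    rw [this, neg_inj]
    exact hB.symm _ _
  have hd {X : VField V V} (hX : IsSmooth X) : DifferentiableAt ℝ (X : V → V) x :=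
    hX.contDiff.differentiable (by simp) x
  have hbr (X Y : VField V V) (v : V) :
      Ω (mlieBracket (realModel V) X Y x) v = Ω (lieBracket ℝ (X : V → V) (Y : V → V) x) v :=
    congrArg (fun w : V => Ω w v) (mlieBracket_vectorSpace X Y x)
  refine Eq.trans ?_ (exteriorDeriv_constant Ω hskew X Y Z x)
  exact congrArg₂ (· - ·) (congrArg₂ (· + ·) (congrArg₂ (· - ·) (congrArg₂ (· + ·)
    (congrArg₂ (· - ·) (mvfderiv_bilin_apply Ω (hd hY) (hd hZ) (X x))
      (mvfderiv_bilin_apply Ω (hd hX) (hd hZ) (Y x)))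
    (mvfderiv_bilin_apply Ω (hd hX) (hd hY) (Z x))) (hbr X Y (Z x))) (hbr X Z (Y x)))
    (hbr Y Z (X x))

theorem differentiableAt_of_mdifferentiableAt {X : VField V V} {x : V}
    (hX : MDifferentiableAt (realModel V) (realModel V).tangent
      (fun x => (⟨x, X x⟩ : TangentBundle (realModel V) V)) x) :
    DifferentiableAt ℝ (X : V → V) x :=
  ((contMDiff_snd_tangentBundle_modelSpace V 𝓘(ℝ, V)).contMDiffAt.mdifferentiableAt
    one_ne_zero |>.comp x hX).differentiableAt

variable (V) in
/-- The trivial connection on a vector space. -/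
noncomputable def trivialConnection : Connection V V where
  toFun X x := (fderiv ℝ (X : V → V) x : V →L[ℝ] V)
  isCovariantDerivativeOnUniv :=
    { add := fun hX hY _ => fderiv_add (differentiableAt_of_mdifferentiableAt hX)
        (differentiableAt_of_mdifferentiableAt hY)
      leibniz := fun hX hf _ => by
        refine (fderiv_smul hf.differentiableAt (differentiableAt_of_mdifferentiableAt hX)).trans ?_
        rw [mvfderiv, mfderiv_eq_fderiv]
        rfl }

/-- A metric with constant coefficients on a vector space is flat. -/
theorem isFlat_of_constant [FiniteDimensional ℂ V] (g : BilinField V V) (B : V →L[ℝ] V →L[ℝ] ℝ)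
    (hg : ∀ x, g x = B) : IsFlat g := by
  have : FiniteDimensional ℝ V := FiniteDimensional.complexToReal V
  obtain rfl : g = fun _ => B := funext hg
  refine ⟨trivialConnection V, ⟨?_, ?_⟩, ?_⟩
  · intro X Y hX hY x v
    exact (mvfderiv_bilin_apply B (hX.contDiff.differentiable (by simp) x)
      (hY.contDiff.differentiable (by simp) x) v).trans (add_comm _ _)
  · refine fun x => congrFun ((trivialConnection V).torsion_eq_zero_iff.2 fun {X Y x} hX hY => ?_) x
    rw [mlieBracket_vectorSpace]
    rfl
  · intro X Y Z hX hY hZ x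
    rw [mlieBracket_vectorSpace]
    -- For the trivial connection, vanishing curvature is the symmetry of the second derivative of
    -- `Z`.
    have h := fderiv_apply_lieBracket (hZ.contDiff.contDiffAt (x := x))
      (by simpa using WithTop.coe_le_coe.2 (le_top (a := (2 : ℕ∞))))
      (hY.contDiff.differentiable (by simp) x) (hX.contDiff.differentiable (by simp) x)
    exact sub_eq_zero.2 h.symm

end ConstantMetric

section VectorGroup

variable {k : ℕ} (g : LeftInvariantHermitianMetric (EuclideanSpace ℂ (Fin k)) (VectorGroup k))

/-- Translations have identity derivative, so left-invariance means constant coefficients. -/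
theorem inner_vectorGroup (x : EuclideanSpace ℂ (Fin k)) :
    g.inner (Multiplicative.ofAdd x) = g.inner 1 := by
  have hd (y : EuclideanSpace ℂ (Fin k)) :
      HasFDerivAt (fun y => x + y) (ContinuousLinearMap.id ℝ (EuclideanSpace ℂ (Fin k))) y :=
    (hasFDerivAt_id y).const_add x
  have hm : HasMFDerivAt (realModel (EuclideanSpace ℂ (Fin k)))
      (realModel (EuclideanSpace ℂ (Fin k)))
      (fun y : VectorGroup k => Multiplicative.ofAdd x * y) 1
      (ContinuousLinearMap.id ℝ (EuclideanSpace ℂ (Fin k)) :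
        EuclideanSpace ℂ (Fin k) →L[ℝ] EuclideanSpace ℂ (Fin k)) :=
    (hd 0).hasMFDerivAt
  ext u v
  have h := g.left_invariant (Multiplicative.ofAdd x) 1 u v
  rw [hm.mfderiv] at h
  have hpoint (y z : VectorGroup k) (hy : y = z) (a b : EuclideanSpace ℂ (Fin k)) :
      g.inner z a b = g.inner y a b := by rw [hy]
  exact (hpoint _ _ (mul_one _) _ _).trans h

theorem isKahler_vectorGroup : IsKahler g.inner :=
  isKahler_of_constant (V := EuclideanSpace ℂ (Fin k)) g.inner (g.inner 1)
    (isHermitianForm_innerOne g) (inner_vectorGroup g)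

theorem isFlat_vectorGroup : IsFlat g.inner :=
  isFlat_of_constant (V := EuclideanSpace ℂ (Fin k)) g.inner (g.inner 1) (inner_vectorGroup g)

end VectorGroup

end LieBTP

theorem theorem3p4 (k r : ℕ)
    (E : Fin r → Type*) [∀ i, NormedAddCommGroup (E i)] [∀ i, NormedSpace ℂ (E i)]
    [∀ i, FiniteDimensional ℂ (E i)]
    (G : Fin r → Type*) [∀ i, TopologicalSpace (G i)] [∀ i, ChartedSpace (E i) (G i)]
    [∀ i, Group (G i)] [∀ i, LieGroup 𝓘(ℂ, E i) ω (G i)]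
    [∀ i, ConnectedSpace (G i)] [∀ i, SimplyConnectedSpace (G i)]
    [∀ i, LieAlgebra.IsSimple ℂ (GroupLieAlgebra 𝓘(ℂ, E i) (G i))] :
    (∀ g : LieBTP.LeftInvariantHermitianMetric (LieBTP.ProductModel k E) (LieBTP.ProductGroup k G),
      LieBTP.IsBTP g.inner →
      ∃ (g₀ : LieBTP.LeftInvariantHermitianMetric (EuclideanSpace ℂ (Fin k)) (LieBTP.VectorGroup k))
        (gs : (i : Fin r) → LieBTP.LeftInvariantHermitianMetric (E i) (G i)),
        LieBTP.IsProductMetric g g₀ gs ∧ LieBTP.IsKahler g₀.inner ∧ LieBTP.IsFlat g₀.inner) ∧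
    (∀ (g h : LieBTP.LeftInvariantHermitianMetric (LieBTP.ProductModel k E)
          (LieBTP.ProductGroup k G))
        (g₀ h₀ : LieBTP.LeftInvariantHermitianMetric (EuclideanSpace ℂ (Fin k))
          (LieBTP.VectorGroup k))
        (gs hs : (i : Fin r) → LieBTP.LeftInvariantHermitianMetric (E i) (G i)),
      LieBTP.IsBTP g.inner → LieBTP.IsBTP h.inner →
      LieBTP.IsProductMetric g g₀ gs → LieBTP.IsProductMetric h h₀ hs →
      ∀ i, LieBTP.DifferByMultipleOfBIsometry (gs i) (hs i)) ∧
    (∀ (i : Fin r) (g h : LieBTP.LeftInvariantHermitianMetric (E i) (G i)),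
      LieBTP.IsBTP g.inner → LieBTP.IsBTP h.inner →
      LieBTP.DifferByMultipleOfBIsometry g h) := by
  refine ⟨fun g hg => ?_, fun g h g₀ h₀ gs hs hg hh hgp hhp i => ?_, fun i g h hg hh => ?_⟩
  · obtain ⟨g₀, gs, hprod⟩ :=
      LieBTP.exists_isProductMetric (LieBTP.hasDerivationAdjoints_of_isBTP g hg)
    exact ⟨g₀, gs, hprod, LieBTP.isKahler_vectorGroup g₀, LieBTP.isFlat_vectorGroup g₀⟩
  · exact LieBTP.differByMultipleOfBIsometry
      (LieBTP.hasDerivationAdjoints_factor (LieBTP.hasDerivationAdjoints_of_isBTP g hg) hgp i)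
      (LieBTP.hasDerivationAdjoints_factor (LieBTP.hasDerivationAdjoints_of_isBTP h hh) hhp i)
  · exact LieBTP.differByMultipleOfBIsometry (LieBTP.hasDerivationAdjoints_of_isBTP g hg)
      (LieBTP.hasDerivationAdjoints_of_isBTP h hh)
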